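/- Let $K$ be a field of characteristic zero. Let $NAP$ be the symmetric $K$-linear operad generated by one binary operation $\prec$ (without symmetry) with the relation $(x\prec y)\prec z=(x\prec z)\prec y$, and let $Moor$ be the symmetric $K$-linear operad generated by one binary operation $\prec$ (without symmetry) with the relations $$(x\prec y)\prec z=(x\prec z)\prec y,\qquad x\prec(y\prec z)=0 .$$ A $Moor$-algebra is an algebra over the operad $Moor$. **Theorem 2.1.** 1. The Ginzburg–Kapranov dual of the quadratic operad $NAP$ is $Moor$: there are a finite-dimensional representation $E$ of $\Sigma_2$ and a $\Sigma_3$-stable subspace $R$ of the space $\mathcal F(E)(3)$ of ternary operations of the free operad $\mathcal F(E)$ on $E$ such that $NAP\cong\mathcal F(E)/(R)$ and $Moor\cong\mathcal F(E^\vee)/(R^\perp)$ as operads, where $E^\vee=E^*\otimes\mathrm{sgn}$ and $R^\perp\subset\mathcal F(E^\vee)(3)\cong\mathcal F(E)(3)^*\otimes\mathrm{sgn}$ is the orthogonal of $R$. 2. For every $K$-vector space $V$ with symmetric algebra $S(V)=K\oplus\bigoplus_{n>0}S^n(V)$ (product written $\vee$), the free $Moor$-algebra over $V$ is $V\otimes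 S(V)$, with the bilinear operation such that, for $v,v'\in V$, $\omega\in S(V)$, $$(v\otimes\omega)\prec(v'\otimes c)=c\,v\otimes(\omega\vee v')\ \text{ for } c\in K,\qquad (v\otimes\omega)\prec(v'\otimes\omega')=0\ \text{ for } \omega'\in S^n(V),\ n>0,$$ and with the inclusion $V\to V\otimes S(V)$, $v\mapsto v\otimes 1$: every linear map from $V$ to a $Moor$-algebra $A$ extends uniquely to a morphism of $Moor$-algebras $V\otimes S(V)\to A$. 3. For all $n\ge 0$ the space $Moor(n)$ of $n$-ary operations has dimension $n$, and the generating series of $Moor$ is $$f_{Moor}(x)=\sum_{n>0}\dim Moor(n)\,\frac{x^n}{n!}=\sum_{n>0}n\,\frac{x^n}{n!}=x e^x .$$ -/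

import Mathlib

open scoped TensorProduct

universe u v w

/-! ## Bijections of finite sets used to write the operad axioms -/

/-- `(S ∪ {*}) ⊔ T ≃ (S ⊔ T) ∪ {*}`. -/
def optionSumEquiv (S T : Type) : Option S ⊕ T ≃ Option (S ⊕ T) where
  toFun
    | Sum.inl none => none
    | Sum.inl (some s) => some (Sum.inl s)
    | Sum.inr t => some (Sum.inr t)
  invFun
    | none => Sum.inl none
    | some (Sum.inl s) => Sum.inl (some s)
    | some (Sum.inr t) => Sum.inr t
  left_inv := by rintro ((_ | _) | _) <;> rfl
  right_inv := by rintro (_ | (_ | _)) <;> rfl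

/-- `S ⊔ (T ∪ {*}) ≃ (S ⊔ T) ∪ {*}`. -/
def sumOptionEquiv (S T : Type) : S ⊕ Option T ≃ Option (S ⊕ T) where
  toFun
    | Sum.inl s => some (Sum.inl s)
    | Sum.inr none => none
    | Sum.inr (some t) => some (Sum.inr t)
  invFun
    | none => Sum.inr none
    | some (Sum.inl s) => Sum.inl s
    | some (Sum.inr t) => Sum.inr (some t)
  left_inv := by rintro (_ | (_ | _)) <;> rfl
  right_inv := by rintro (_ | (_ | _)) <;> rfl

/-- The bijection of `S ∪ {*₁} ∪ {*₂}` that exchanges the two added points. -/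
def optionSwapEquiv (S : Type) : Option (Option S) ≃ Option (Option S) where
  toFun
    | none => some none
    | some none => none
    | some (some s) => some (some s)
  invFun
    | none => some none
    | some none => none
    | some (some s) => some (some s)
  left_inv := by rintro (_ | (_ | _)) <;> rfl
  right_inv := by rintro (_ | (_ | _)) <;> rfl

/-- `(S ⊔ T) ⊔ U ≃ (S ⊔ U) ⊔ T`. -/
def sumRightCommEquiv (S T U : Type) : (S ⊕ T) ⊕ U ≃ (S ⊕ U) ⊕ T where
  toFun
    | Sum.inl (Sum.inl s) => Sum.inl (Sum.inl s)
    | Sum.inl (Sum.inr t) => Sum.inr t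
    | Sum.inr u => Sum.inl (Sum.inr u)
  invFun
    | Sum.inl (Sum.inl s) => Sum.inl (Sum.inl s)
    | Sum.inl (Sum.inr u) => Sum.inr u
    | Sum.inr t => Sum.inl (Sum.inr t)
  left_inv := by rintro ((_ | _) | _) <;> rfl
  right_inv := by rintro ((_ | _) | _) <;> rfl

/-- The one-point set as the empty set with a point added. -/
def unitOptionEquiv : Unit ≃ Option Empty where
  toFun _ := none
  invFun _ := ()
  left_inv _ := rfl
  right_inv := by rintro (_ | x); exacts [rfl, x.elim]

/-! ## Symmetric operads -/

/-- A (symmetric, unital, `K`-linear) operad in coordinate-free form: for each finite set `S` a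
`K`-vector space `obj S` of operations whose inputs are labelled by `S`, functorial in bijections
of `S`, with a unit and partial compositions. `comp p q` inserts the output of `q` in the input
`none` of `p`. Operations of arity `n` are `obj (Fin n)`, with its action of the symmetric group
through `map`. -/
structure Operad (K : Type u) [Field K] where
  obj : (S : Type) → [Finite S] → Type u
  [instAddCommGroup : ∀ (S : Type) [Finite S], AddCommGroup (obj S)]
  [instModule : ∀ (S : Type) [Finite S], Module K (obj S)]
  map : ∀ {S T : Type} [Finite S] [Finite T], (S ≃ T) → obj S →ₗ[K] obj T
  one : obj Unit
  comp : ∀ {S T : Type} [Finite S] [Finite T], obj (Option S) →ₗ[K] obj T →ₗ[K] obj (S ⊕ T)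
  map_refl : ∀ {S : Type} [Finite S] (p : obj S), map (Equiv.refl S) p = p
  map_trans : ∀ {S T U : Type} [Finite S] [Finite T] [Finite U] (σ : S ≃ T) (τ : T ≃ U)
    (p : obj S), map (σ.trans τ) p = map τ (map σ p)
  comp_map : ∀ {S T S' T' : Type} [Finite S] [Finite T] [Finite S'] [Finite T']
    (σ : S ≃ S') (τ : T ≃ T') (p : obj (Option S)) (q : obj T),
    comp (map (Equiv.optionCongr σ) p) (map τ q) = map (Equiv.sumCongr σ τ) (comp p q)
  one_comp : ∀ {T : Type} [Finite T] (q : obj T),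
    comp (map unitOptionEquiv one) q = map (Equiv.emptySum Empty T).symm q
  comp_one : ∀ {S : Type} [Finite S] (p : obj (Option S)),
    comp p one = map (Equiv.optionEquivSumPUnit S) p
  /-- sequential associativity -/
  comp_assoc : ∀ {S T U : Type} [Finite S] [Finite T] [Finite U]
    (p : obj (Option S)) (q : obj (Option T)) (r : obj U),
    map (Equiv.sumAssoc S T U) (comp (map (sumOptionEquiv S T) (comp p q)) r) =
      comp p (comp q r)
  /-- parallel associativity -/
  comp_comm : ∀ {S T U : Type} [Finite S] [Finite T] [Finite U]
    (p : obj (Option (Option S))) (q : obj T) (r : obj U),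
    map (sumRightCommEquiv S T U) (comp (map (optionSumEquiv S T) (comp p q)) r) =
      comp (map (optionSumEquiv S U) (comp (map (optionSwapEquiv S) p) r)) q

attribute [instance] Operad.instAddCommGroup Operad.instModule

namespace Operad

variable {K : Type u} [Field K]

/-- Isomorphisms of operads. -/
structure Iso (P Q : Operad K) where
  equiv : ∀ (S : Type) [Finite S], P.obj S ≃ₗ[K] Q.obj S
  equiv_map : ∀ {S T : Type} [Finite S] [Finite T] (σ : S ≃ T) (p : P.obj S),
    equiv T (P.map σ p) = Q.map σ (equiv S p)
  equiv_one : equiv Unit P.one = Q.one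
  equiv_comp : ∀ {S T : Type} [Finite S] [Finite T] (p : P.obj (Option S)) (q : P.obj T),
    equiv (S ⊕ T) (P.comp p q) = Q.comp (equiv (Option S) p) (equiv T q)

/-- The generating series `∑_{n ≥ 1} dim P(n) xⁿ / n!`. -/
noncomputable def genSeries (P : Operad K) : PowerSeries ℚ :=
  PowerSeries.mk fun n =>
    if n = 0 then 0 else (Module.finrank K (P.obj (Fin n)) : ℚ) / (n.factorial : ℚ)

/-! ### Algebras over an operad -/

/-- A structure of algebra over the operad `P` on the vector space `A`: every operation with
inputs labelled by `S` acts as a multilinear map `A^S → A`, compatibly with relabelling, unit and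
composition. (That is, a morphism of operads from `P` to the endomorphism operad of `A`.) -/
structure Algebra (P : Operad K) (A : Type v) [AddCommGroup A] [Module K A] where
  act : ∀ {S : Type} [Finite S], P.obj S →ₗ[K] MultilinearMap K (fun _ : S => A) A
  act_map : ∀ {S T : Type} [Finite S] [Finite T] (σ : S ≃ T) (p : P.obj S) (a : T → A),
    act (P.map σ p) a = act p (fun s => a (σ s))
  act_one : ∀ a : Unit → A, act P.one a = a ()
  act_comp : ∀ {S T : Type} [Finite S] [Finite T] (p : P.obj (Option S)) (q : P.obj T)
    (a : S ⊕ T → A),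
    act (P.comp p q) a =
      act p (fun o => o.elim (act q fun t => a (Sum.inr t)) fun s => a (Sum.inl s))

/-- A linear map is a morphism of `P`-algebras when it commutes with all operations. -/
def Algebra.IsHom {P : Operad K} {A : Type v} [AddCommGroup A] [Module K A]
    {B : Type w} [AddCommGroup B] [Module K B] (α : P.Algebra A) (β : P.Algebra B)
    (f : A →ₗ[K] B) : Prop :=
  ∀ (S : Type) [Finite S] (p : P.obj S) (a : S → A), f (α.act p a) = β.act p (fun s => f (a s))

/-! ### Ideals and quotients -/

/-- The operadic ideal generated by a set `R` of operations of arity `n`. -/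
inductive IdealMem (P : Operad K) (n : ℕ) (R : Set (P.obj (Fin n))) :
    ∀ (S : Type) [Finite S], P.obj S → Prop
  | rel (r : P.obj (Fin n)) (hr : r ∈ R) : IdealMem P n R (Fin n) r
  | zero (S : Type) [Finite S] : IdealMem P n R S 0
  | add (S : Type) [Finite S] (p q : P.obj S) (hp : IdealMem P n R S p)
      (hq : IdealMem P n R S q) : IdealMem P n R S (p + q)
  | smul (S : Type) [Finite S] (c : K) (p : P.obj S) (hp : IdealMem P n R S p) :
      IdealMem P n R S (c • p)
  | map (S T : Type) [Finite S] [Finite T] (σ : S ≃ T) (p : P.obj S)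
      (hp : IdealMem P n R S p) : IdealMem P n R T (P.map σ p)
  | comp_left (S T : Type) [Finite S] [Finite T] (p : P.obj (Option S)) (q : P.obj T)
      (hp : IdealMem P n R (Option S) p) : IdealMem P n R (S ⊕ T) (P.comp p q)
  | comp_right (S T : Type) [Finite S] [Finite T] (p : P.obj (Option S)) (q : P.obj T)
      (hq : IdealMem P n R T q) : IdealMem P n R (S ⊕ T) (P.comp p q)

/-- The component at `S` of the ideal generated by `R`. -/
def ideal (P : Operad K) (n : ℕ) (R : Set (P.obj (Fin n))) (S : Type) [Finite S] :
    Submodule K (P.obj S) where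
  carrier := {p | IdealMem P n R S p}
  add_mem' hp hq := .add S _ _ hp hq
  zero_mem' := .zero S
  smul_mem' c _ hp := .smul S c _ hp

/-- The partial composition of a quotient operad. -/
def quotientComp (P : Operad K) (n : ℕ) (R : Set (P.obj (Fin n))) (S T : Type) [Finite S]
    [Finite T] :
    (P.obj (Option S) ⧸ P.ideal n R (Option S)) →ₗ[K]
      (P.obj T ⧸ P.ideal n R T) →ₗ[K] (P.obj (S ⊕ T) ⧸ P.ideal n R (S ⊕ T)) :=
  Submodule.liftQ _
    (LinearMap.mk₂ K
      (fun p q => Submodule.mapQ (P.ideal n R T) (P.ideal n R (S ⊕ T)) (P.comp p)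
        (fun q hq => IdealMem.comp_right S T p q hq) q)
      (fun p p' q => by
        obtain ⟨q, rfl⟩ := Submodule.mkQ_surjective _ q
        exact congrArg (P.ideal n R (S ⊕ T)).mkQ (LinearMap.congr_fun (map_add P.comp p p') q))
      (fun c p q => by
        obtain ⟨q, rfl⟩ := Submodule.mkQ_surjective _ q
        exact congrArg (P.ideal n R (S ⊕ T)).mkQ (LinearMap.congr_fun (map_smul P.comp c p) q))
      (fun p q q' => map_add _ _ _)
      (fun c p q => map_smul _ _ _))
    (fun p hp => by
      rw [LinearMap.mem_ker]
      ext q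
      exact (Submodule.Quotient.mk_eq_zero _).2 (IdealMem.comp_left S T p q hp))

/-- The quotient of the operad `P` by the ideal generated by the set `R` of operations of
arity `n`. -/
def quotient (P : Operad K) (n : ℕ) (R : Set (P.obj (Fin n))) : Operad K where
  obj S _ := P.obj S ⧸ P.ideal n R S
  map {S T} _ _ σ := Submodule.mapQ (P.ideal n R S) (P.ideal n R T) (P.map σ)
    (fun p hp => IdealMem.map S T σ p hp)
  one := Submodule.Quotient.mk P.one
  comp {S T} _ _ := P.quotientComp n R S T
  map_refl p := by
    obtain ⟨p, rfl⟩ := Submodule.mkQ_surjective _ p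
    exact congrArg (P.ideal n R _).mkQ (P.map_refl p)
  map_trans σ τ p := by
    obtain ⟨p, rfl⟩ := Submodule.mkQ_surjective _ p
    exact congrArg (P.ideal n R _).mkQ (P.map_trans σ τ p)
  comp_map σ τ p q := by
    obtain ⟨p, rfl⟩ := Submodule.mkQ_surjective _ p
    obtain ⟨q, rfl⟩ := Submodule.mkQ_surjective _ q
    exact congrArg (P.ideal n R _).mkQ (P.comp_map σ τ p q)
  one_comp q := by
    obtain ⟨q, rfl⟩ := Submodule.mkQ_surjective _ q
    exact congrArg (P.ideal n R _).mkQ (P.one_comp q)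
  comp_one p := by
    obtain ⟨p, rfl⟩ := Submodule.mkQ_surjective _ p
    exact congrArg (P.ideal n R _).mkQ (P.comp_one p)
  comp_assoc p q r := by
    obtain ⟨p, rfl⟩ := Submodule.mkQ_surjective _ p
    obtain ⟨q, rfl⟩ := Submodule.mkQ_surjective _ q
    obtain ⟨r, rfl⟩ := Submodule.mkQ_surjective _ r
    exact congrArg (P.ideal n R _).mkQ (P.comp_assoc p q r)
  comp_comm p q r := by
    obtain ⟨p, rfl⟩ := Submodule.mkQ_surjective _ p
    obtain ⟨q, rfl⟩ := Submodule.mkQ_surjective _ q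
    obtain ⟨r, rfl⟩ := Submodule.mkQ_surjective _ r
    exact congrArg (P.ideal n R _).mkQ (P.comp_comm p q r)

/-- The projection of an operad on a quotient. -/
def toQuotient (P : Operad K) (n : ℕ) (R : Set (P.obj (Fin n))) (S : Type) [Finite S] :
    P.obj S →ₗ[K] (P.quotient n R).obj S :=
  (P.ideal n R S).mkQ

end Operad

/-! ## Free operads on binary operations -/

/-- Planar binary trees with vertices decorated by `X` and leaves by `S`. -/
inductive BinTree (X : Type u) (S : Type) : Type u
  | leaf : S → BinTree X S
  | node : X → BinTree X S → BinTree X S → BinTree X S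

namespace BinTree

variable {X : Type u} {S T U : Type}

/-- Substitution of trees in the leaves of a tree. -/
def bind : BinTree X S → (S → BinTree X T) → BinTree X T
  | leaf s, f => f s
  | node x l r, f => node x (l.bind f) (r.bind f)

/-- The leaf labels from left to right. -/
def leaves : BinTree X S → List S
  | leaf s => [s]
  | node _ l r => l.leaves ++ r.leaves

/-- Every element of `S` labels exactly one leaf. -/
def IsLinear (t : BinTree X S) : Prop := t.leaves.Nodup ∧ ∀ s, s ∈ t.leaves

theorem bind_bind (t : BinTree X S) (f : S → BinTree X T) (g : T → BinTree X U) :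
    (t.bind f).bind g = t.bind fun s => (f s).bind g := by
  induction t with
  | leaf s => rfl
  | node x l r hl hr => simp [bind, hl, hr]

theorem bind_leaf (t : BinTree X S) : t.bind leaf = t := by
  induction t with
  | leaf s => rfl
  | node x l r hl hr => simp [bind, hl, hr]

theorem leaves_bind (t : BinTree X S) (f : S → BinTree X T) :
    (t.bind f).leaves = t.leaves.flatMap fun s => (f s).leaves := by
  induction t with
  | leaf s => simp [bind, leaves]
  | node x l r hl hr => simp [bind, leaves, hl, hr]

/-- What is substituted in the leaf `s` to graft `u` on the leaf `none`. -/
def graftFun (u : BinTree X T) : Option S → BinTree X (S ⊕ T)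
  | none => u.bind fun t => leaf (Sum.inr t)
  | some s => leaf (Sum.inl s)

theorem IsLinear.map {t : BinTree X S} (ht : t.IsLinear) (σ : S ≃ T) :
    (t.bind fun s => leaf (σ s)).IsLinear := by
  have h : (t.bind fun s => leaf (σ s)).leaves = t.leaves.map σ := by
    simp [leaves_bind, leaves]
    induction t.leaves <;> simp_all
  refine ⟨h ▸ ht.1.map σ.injective, fun s => ?_⟩
  rw [h, List.mem_map]
  exact ⟨σ.symm s, ht.2 _, by simp⟩

theorem mem_leaves_graftFun (u : BinTree X T) (o : Option S) (x : S ⊕ T) :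
    x ∈ (graftFun u o).leaves ↔
      (∃ t ∈ u.leaves, o = none ∧ x = Sum.inr t) ∨ ∃ s, o = some s ∧ x = Sum.inl s := by
  cases o with
  | none => simp [graftFun, leaves_bind, leaves]
  | some s => simp [graftFun, leaves]

theorem IsLinear.graft {t : BinTree X (Option S)} {u : BinTree X T} (ht : t.IsLinear)
    (hu : u.IsLinear) : (t.bind (graftFun u)).IsLinear := by
  constructor
  · rw [leaves_bind, List.nodup_flatMap]
    refine ⟨fun o _ => ?_, ?_⟩
    · cases o with
      | some s => simp [graftFun, leaves]
      | none =>
        simp only [graftFun, leaves_bind, leaves]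
        rw [List.nodup_flatMap]
        refine ⟨fun _ _ => List.nodup_singleton _, hu.1.imp fun {a b} hab => ?_⟩
        simpa [Function.onFun] using hab.symm
    · refine ht.1.imp fun {a b} hab => ?_
      intro x hxa hxb
      rw [mem_leaves_graftFun] at hxa hxb
      rcases hxa with ⟨_, _, rfl, rfl⟩ | ⟨_, rfl, rfl⟩ <;>
        rcases hxb with ⟨_, _, rfl, h⟩ | ⟨_, rfl, h⟩ <;> simp_all
  · intro x
    rw [leaves_bind, List.mem_flatMap]
    rcases x with s | s
    · exact ⟨some s, ht.2 _, by simp [mem_leaves_graftFun]⟩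
    · exact ⟨none, ht.2 _, by simpa [mem_leaves_graftFun] using hu.2 s⟩

end BinTree

/-- Planar binary trees with vertices decorated by `X` and leaves labelled bijectively by `S`. -/
def LinTree (X : Type u) (S : Type) : Type u := {t : BinTree X S // t.IsLinear}

namespace LinTree

variable {X : Type u} {S T : Type}

/-- Relabelling of the leaves. -/
def map (σ : S ≃ T) (t : LinTree X S) : LinTree X T := ⟨_, t.2.map σ⟩

/-- The tree with one leaf and no vertex. -/
def one : LinTree X Unit := ⟨.leaf (), by simp [BinTree.IsLinear, BinTree.leaves]⟩

/-- Grafting of `u` on the leaf `none` of `t`. -/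
def comp (t : LinTree X (Option S)) (u : LinTree X T) : LinTree X (S ⊕ T) := ⟨_, t.2.graft u.2⟩

/-- The tree `x(0, 1)`. -/
def corolla (x : X) : LinTree X (Fin 2) :=
  ⟨.node x (.leaf 0) (.leaf 1), by
    refine ⟨by simp [BinTree.leaves], fun s => ?_⟩
    fin_cases s <;> simp [BinTree.leaves]⟩

end LinTree

section Free

variable (K : Type u) [Field K] (X : Type u)

/-- The partial composition of the free operad: bilinear extension of the grafting of trees. -/
noncomputable def freeComp (S T : Type) :
    (LinTree X (Option S) →₀ K) →ₗ[K] (LinTree X T →₀ K) →ₗ[K] (LinTree X (S ⊕ T) →₀ K) :=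
  Finsupp.linearCombination K fun t => Finsupp.lmapDomain K K (LinTree.comp t)

variable {K X} in
theorem freeComp_single {S T : Type} (t : LinTree X (Option S)) (u : LinTree X T) (a b : K) :
    freeComp K X S T (Finsupp.single t a) (Finsupp.single u b) =
      Finsupp.single (t.comp u) (a * b) := by
  simp [freeComp]

/-- The free operad on a set `X` of binary operations without symmetries: the operations with
inputs labelled by `S` have as basis the planar binary trees with vertices decorated by `X` and
leaves labelled bijectively by `S`. -/
noncomputable def freeOperad : Operad K where
  obj S _ := LinTree X S →₀ K
  map σ := Finsupp.lmapDomain K K (LinTree.map σ)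
  one := Finsupp.single LinTree.one 1
  comp {S T} _ _ := freeComp K X S T
  map_refl p := by
    induction p using Finsupp.induction_linear with
    | zero => simp
    | add p q hp hq => rw [map_add, hp, hq]
    | single t a =>
      simp only [Finsupp.lmapDomain_apply, Finsupp.mapDomain_single]
      congr 1
      exact Subtype.ext (BinTree.bind_leaf t.1)
  map_trans σ τ p := by
    induction p using Finsupp.induction_linear with
    | zero => simp
    | add p q hp hq => simp only [map_add, hp, hq]
    | single t a =>
      simp only [Finsupp.lmapDomain_apply, Finsupp.mapDomain_single]
      congr 1
      exact Subtype.ext (by simp [LinTree.map, BinTree.bind_bind, BinTree.bind])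
  comp_map σ τ p q := by
    induction p using Finsupp.induction_linear with
    | zero => simp
    | add p q hp hq => simp only [map_add, LinearMap.add_apply, hp, hq]
    | single t a =>
      induction q using Finsupp.induction_linear with
      | zero => simp
      | add p q hp hq => simp only [map_add, hp, hq]
      | single u b =>
        simp only [Finsupp.lmapDomain_apply, Finsupp.mapDomain_single, freeComp_single]
        congr 1
        refine Subtype.ext ?_
        simp only [LinTree.map, LinTree.comp, BinTree.bind_bind]
        congr 1
        funext o
        cases o <;> simp [BinTree.bind, BinTree.graftFun, BinTree.bind_bind]
  one_comp q := by
    induction q using Finsupp.induction_linear with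
    | zero => simp
    | add p q hp hq => simp only [map_add, hp, hq]
    | single u b =>
      simp only [Finsupp.lmapDomain_apply, Finsupp.mapDomain_single, freeComp_single, one_mul]
      congr 1
  comp_one p := by
    induction p using Finsupp.induction_linear with
    | zero => simp
    | add p q hp hq => simp only [map_add, LinearMap.add_apply, hp, hq]
    | single t a =>
      simp only [Finsupp.lmapDomain_apply, Finsupp.mapDomain_single, freeComp_single, mul_one]
      congr 1
      refine Subtype.ext ?_
      simp only [LinTree.map, LinTree.comp]
      congr 1
      funext o
      cases o <;> simp [BinTree.bind, BinTree.graftFun, LinTree.one]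
  comp_assoc p q r := by
    induction p using Finsupp.induction_linear with
    | zero => simp
    | add p q hp hq => simp only [map_add, LinearMap.add_apply, hp, hq]
    | single t a =>
      induction q using Finsupp.induction_linear with
      | zero => simp
      | add p q hp hq => simp only [map_add, LinearMap.add_apply, hp, hq]
      | single u b =>
        induction r using Finsupp.induction_linear with
        | zero => simp
        | add p q hp hq => simp only [map_add, hp, hq]
        | single s c =>
          simp only [Finsupp.lmapDomain_apply, Finsupp.mapDomain_single, freeComp_single,
            mul_assoc]
          congr 1
          refine Subtype.ext ?_
          simp only [LinTree.map, LinTree.comp, BinTree.bind_bind]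
          congr 1
          funext o
          cases o with
          | some o => simp [BinTree.bind, BinTree.graftFun, sumOptionEquiv]
          | none =>
            simp only [BinTree.bind, BinTree.graftFun, BinTree.bind_bind]
            congr 1
            funext o
            cases o <;> simp [BinTree.bind, sumOptionEquiv, BinTree.bind_bind]
  comp_comm p q r := by
    induction p using Finsupp.induction_linear with
    | zero => simp
    | add p q hp hq => simp only [map_add, LinearMap.add_apply, hp, hq]
    | single t a =>
      induction q using Finsupp.induction_linear with
      | zero => simp
      | add p q hp hq => simp only [map_add, LinearMap.add_apply, hp, hq]
      | single u b =>
        induction r using Finsupp.induction_linear with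
        | zero => simp
        | add p q hp hq => simp only [map_add, LinearMap.add_apply, hp, hq]
        | single s c =>
          simp only [Finsupp.lmapDomain_apply, Finsupp.mapDomain_single, freeComp_single,
            mul_right_comm]
          congr 1
          refine Subtype.ext ?_
          simp only [LinTree.map, LinTree.comp, BinTree.bind_bind]
          congr 1
          funext o
          rcases o with _ | _ | o <;>
            simp [BinTree.bind, BinTree.graftFun, optionSumEquiv, optionSwapEquiv,
              sumRightCommEquiv, BinTree.bind_bind]

end Free

/-! ## Binary quadratic operads and their Ginzburg–Kapranov duals -/

/-- Binary quadratic data. `E` is a finite-dimensional representation of the symmetric group on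
two letters (`swap` is the action of the transposition), the space of generating operations.
The arity-three part of the free operad on `E` is the sum of three copies of `E ⊗ E`: in a family
`w : Fin 3 → E ⊗ E`, the entry `e ⊗ f` at `i` stands for the operation
`e (f (x_{i+1}, x_{i+2}), x_i)`, indices modulo 3. The space of relations `rel` has to be stable
under the symmetric group: a permutation `σ` moves the entry at `i` to `σ i`, where it is
`e (f (x_{σ(i+1)}, x_{σ(i+2)}), x_{σ i})`, so that `f` is replaced by `swap f` if `σ` is odd. -/
structure QuadraticData (K : Type u) [Field K] where
  E : Type u
  [instAddCommGroup : AddCommGroup E]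
  [instModule : Module K E]
  [instFinite : Module.Finite K E]
  swap : E →ₗ[K] E
  swap_swap : ∀ e, swap (swap e) = e
  rel : Submodule K (Fin 3 → E ⊗[K] E)
  rel_stable : ∀ (σ : Equiv.Perm (Fin 3)), ∀ w ∈ rel,
    (fun i => if Equiv.Perm.sign σ = 1 then w (σ.symm i)
      else LinearMap.lTensor E swap (w (σ.symm i))) ∈ rel

attribute [instance] QuadraticData.instAddCommGroup QuadraticData.instModule
  QuadraticData.instFinite

namespace QuadraticData

variable {K : Type u} [Field K] (D : QuadraticData K)

/-- A generator, seen in the free operad on the underlying set of `E`. -/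
noncomputable def preGen (e : D.E) : (freeOperad K D.E).obj (Fin 2) :=
  Finsupp.single (LinTree.corolla e) (1 : K)

/-- The relations which make `E → P(2)` linear and equivariant. -/
def linearRelations : Set ((freeOperad K D.E).obj (Fin 2)) :=
  {p | ∃ e f : D.E, p = D.preGen (e + f) - (D.preGen e + D.preGen f)} ∪
  {p | ∃ (c : K) (e : D.E), p = D.preGen (c • e) - c • D.preGen e} ∪
  {p | ∃ e : D.E, p = D.preGen (D.swap e) -
    (freeOperad K D.E).map (Equiv.swap (0 : Fin 2) 1) (D.preGen e)}

/-- The free operad on the representation `E`, placed in arity two. -/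
noncomputable def free : Operad K := (freeOperad K D.E).quotient 2 D.linearRelations

/-- The inclusion of the generators in the free operad. -/
noncomputable def gen : D.E →ₗ[K] D.free.obj (Fin 2) where
  toFun e := (freeOperad K D.E).toQuotient 2 D.linearRelations (Fin 2) (D.preGen e)
  map_add' e f := by
    exact (Submodule.Quotient.eq ((freeOperad K D.E).ideal 2 D.linearRelations (Fin 2))).2
      (Operad.IdealMem.rel _ (Or.inl (Or.inl ⟨e, f, rfl⟩)))
  map_smul' c e := by
    exact (Submodule.Quotient.eq ((freeOperad K D.E).ideal 2 D.linearRelations (Fin 2))).2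
      (Operad.IdealMem.rel _ (Or.inl (Or.inr ⟨c, e, rfl⟩)))

/-- The operation `e (f (x_{i+1}, x_{i+2}), x_i)` of the free operad, bilinear in `e` and `f`. -/
noncomputable def compAt (i : Fin 3) : D.E →ₗ[K] D.E →ₗ[K] D.free.obj (Fin 3) :=
  ((D.free.comp.compl₁₂ (D.free.map (finSuccEquiv 1) ∘ₗ D.gen) D.gen).compr₂
    (D.free.map (finSumFinEquiv : Fin 1 ⊕ Fin 2 ≃ Fin 3))).compr₂
    (D.free.map (Equiv.addLeft i))

/-- The identification of the sum of three copies of `E ⊗ E` with the operations of arity three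
of the free operad. -/
noncomputable def toFree : (Fin 3 → D.E ⊗[K] D.E) →ₗ[K] D.free.obj (Fin 3) :=
  ∑ i : Fin 3, TensorProduct.lift (D.compAt i) ∘ₗ LinearMap.proj i

/-- The quadratic operad `P(E, R)`: the free operad on `E` modulo the ideal generated by the
relations. -/
noncomputable def operad : Operad K := D.free.quotient 3 (D.toFree '' D.rel)

/-- The pairing of the arity-three parts of the free operads on `E` and on its dual. -/
noncomputable def pairing (φ : Fin 3 → Module.Dual K D.E ⊗[K] Module.Dual K D.E)
    (w : Fin 3 → D.E ⊗[K] D.E) : K :=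
  ∑ i : Fin 3, TensorProduct.dualDistrib K D.E D.E (φ i) (w i)

theorem dualDistrib_lTensor (φ : Module.Dual K D.E ⊗[K] Module.Dual K D.E) (w : D.E ⊗[K] D.E) :
    TensorProduct.dualDistrib K D.E D.E
      (LinearMap.lTensor _ (-(Module.Dual.transpose D.swap)) φ) w =
    -TensorProduct.dualDistrib K D.E D.E φ (LinearMap.lTensor _ D.swap w) := by
  induction φ using TensorProduct.induction_on with
  | zero => simp
  | add φ ψ h h' => simp only [map_add, LinearMap.add_apply, h, h', neg_add]
  | tmul φ ψ =>
    induction w using TensorProduct.induction_on with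
    | zero => simp
    | add φ ψ h h' => simp only [map_add, h, h', neg_add]
    | tmul e f =>
      simp only [LinearMap.lTensor_tmul, TensorProduct.dualDistrib_apply]
      exact mul_neg _ _

/-- The dual data: the generators are `E^∨ = E* ⊗ sgn` and the relations are the orthogonal of
the relations. -/
noncomputable def dual : QuadraticData K where
  E := Module.Dual K D.E
  swap := -(Module.Dual.transpose D.swap)
  swap_swap φ := by
    ext e
    simp [Module.Dual.transpose, D.swap_swap]
  rel :=
    { carrier := {φ | ∀ w ∈ D.rel, D.pairing φ w = 0}
      add_mem' := fun {φ ψ} hφ hψ w hw => by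
        have h1 := hφ w hw
        have h2 := hψ w hw
        simp only [pairing] at h1 h2 ⊢
        simp [Finset.sum_add_distrib, h1, h2]
      zero_mem' := fun w _ => by simp [pairing]
      smul_mem' := fun c φ hφ w hw => by
        have h1 := hφ w hw
        simp only [pairing] at h1 ⊢
        simp [← Finset.mul_sum, h1] }
  rel_stable σ φ hφ w hw := by
    have h := hφ _ (D.rel_stable σ⁻¹ w hw)
    simp only [pairing] at h ⊢
    rw [← Equiv.sum_comp σ]
    by_cases hs : Equiv.Perm.sign σ = 1
    · simpa [hs, Equiv.Perm.inv_def] using h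
    · simp only [hs, if_false, Equiv.Perm.sign_inv, Equiv.symm_apply_apply,
        dualDistrib_lTensor, Finset.sum_neg_distrib, neg_eq_zero] at h ⊢
      simpa [Equiv.Perm.inv_def] using h

end QuadraticData

/-- `Q` is the Ginzburg–Kapranov (quadratic) dual of `P`: the operad `P` is the quadratic operad
`P(E, R)` for some binary quadratic data, and `Q` is `P(E^∨, R^⊥)`. -/
def Operad.IsQuadraticDual {K : Type u} [Field K] (P Q : Operad K) : Prop :=
  ∃ D : QuadraticData K, Nonempty (P.Iso D.operad) ∧ Nonempty (Q.Iso D.dual.operad)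

/-! ## The operads `NAP` and `Moor` -/

section Moor

variable (K : Type u) [Field K]

/-- The basis element `(x_i ≺ x_j) ≺ x_k` of the free operad on one binary operation `≺`. -/
noncomputable def leftComb (i j k : Fin 3) (h : [i, j, k].Nodup) :
    (freeOperad K PUnit.{u + 1}).obj (Fin 3) :=
  Finsupp.single (⟨.node .unit (.node .unit (.leaf i) (.leaf j)) (.leaf k), h, by
    change ∀ s, s ∈ [i, j, k]; revert i j k; decide⟩ : LinTree PUnit.{u + 1} (Fin 3)) (1 : K)

/-- The basis element `x_i ≺ (x_j ≺ x_k)` of the free operad on one binary operation `≺`. -/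
noncomputable def rightComb (i j k : Fin 3) (h : [i, j, k].Nodup) :
    (freeOperad K PUnit.{u + 1}).obj (Fin 3) :=
  Finsupp.single (⟨.node .unit (.leaf i) (.node .unit (.leaf j) (.leaf k)), h, by
    change ∀ s, s ∈ [i, j, k]; revert i j k; decide⟩ : LinTree PUnit.{u + 1} (Fin 3)) (1 : K)

/-- The operad of nonassociative permutative algebras: one operation `≺` with
`(x ≺ y) ≺ z = (x ≺ z) ≺ y`. -/
noncomputable def NAP : Operad K :=
  (freeOperad K PUnit.{u + 1}).quotient 3
    {leftComb K 0 1 2 (by decide) - leftComb K 0 2 1 (by decide)}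

/-- The relations of `Moor`: `(x ≺ y) ≺ z = (x ≺ z) ≺ y` and `x ≺ (y ≺ z) = 0`. -/
noncomputable def moorRelations : Set ((freeOperad K PUnit.{u + 1}).obj (Fin 3)) :=
  {leftComb K 0 1 2 (by decide) - leftComb K 0 2 1 (by decide), rightComb K 0 1 2 (by decide)}

/-- The operad `Moor`. -/
noncomputable def Moor : Operad K := (freeOperad K PUnit.{u + 1}).quotient 3 (moorRelations K)

/-- The generating operation `x_0 ≺ x_1` of `Moor`. -/
noncomputable def moorGen : (Moor K).obj (Fin 2) :=
  (freeOperad K PUnit.{u + 1}).toQuotient 3 (moorRelations K) (Fin 2)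
    (Finsupp.single (LinTree.corolla .unit) (1 : K))

variable {K} in
/-- The operation `a ≺ b` of a `Moor`-algebra. -/
noncomputable def moorOp {A : Type v} [AddCommGroup A] [Module K A] (α : (Moor K).Algebra A)
    (a b : A) : A :=
  α.act (moorGen K) ![a, b]

end Moor

/-!
The three parts of the theorem rest on the same two facts about trees.

* A linear tree is built from corollas by relabelling and grafting (`LinTree.induction`), so that
  whatever holds for corollas and is compatible with the operad structure holds for all operations.
* Bilinear operations on a vector space `A` evaluate linear trees to multilinear maps, which makes
  `A` an algebra over the free operad (`treeAlgebra`), and over a quotient as soon as the relations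
  act by zero (`Operad.Algebra.quotient`).

*Duality.* Let `E` be the regular representation of the symmetric group on two letters, with basis
`e₀ = x₀ ≺ x₁` and `e₁ = x₁ ≺ x₀`. The free operad on one operation maps to the free operad on the
representation `E`. The map is onto because the image contains the generators, and it is injective
because the free operad on one operation acts faithfully on magmatic algebras, an action which
extends to the free operad on `E` by letting `e₁` act as the opposite operation
(`QuadraticData.freeIso`). Through this isomorphism the twelve vectors `e_j ⊗ e_k` at the three
positions are the twelve combs with three leaves, and the relations of `NAP` become the equations
`napData`. In the basis `e₀*, -e₁*` of `E^∨`, their orthogonal has the same equations between left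
combs and no condition on the right combs, that is, it consists of the relations of `Moor`.

*Free algebras.* The right multiplications of a `Moor`-algebra `A` commute with each other, so a
linear map `f : V → A` extends to an action of `S(V)` on `A`; the morphism `V ⊗ S(V) → A` is
`v ⊗ ω ↦ ω · f v`. It is compatible with the operation since right multiplication by a product is
zero (`moorOp_action`).

*Dimensions.* In `Moor(S)` every tree is zero or a left comb, and a left comb depends only on its
leftmost leaf: the labels of the other leaves can be permuted (`toMoor_comb_perm`), and the combs
span a subspace closed under composition (`comp_mem_combSpan`). The combs with different leftmost
leaves are independent, because at the basis vectors `e_s` of `V = K^S` they take the values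
`e_s ⊗ ∏_{t ≠ s} e_t` in the free algebra `V ⊗ S(V)`.
-/

/-! ### Linear trees and their evaluation -/

namespace BinTree

variable {X : Type u} {S T : Type}

theorem leaves_bind_leaf (t : BinTree X S) (f : S → T) :
    (t.bind fun s => leaf (f s)).leaves = t.leaves.map f := by
  induction t with
  | leaf s => rfl
  | node x l r hl hr => simp [bind, leaves, hl, hr]

theorem exists_bind_val {p : S → Prop} (t : BinTree X S) (h : ∀ s ∈ t.leaves, p s) :
    ∃ t' : BinTree X {s // p s}, (t'.bind fun s => leaf s.1) = t := by
  induction t with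
  | leaf s => exact ⟨leaf ⟨s, h s (by simp [leaves])⟩, rfl⟩
  | node x l r hl hr =>
    obtain ⟨l', rfl⟩ := hl fun s hs => h s (by simp [leaves, hs])
    obtain ⟨r', rfl⟩ := hr fun s hs => h s (by simp [leaves, hs])
    exact ⟨node x l' r', rfl⟩

/-- A tree without repeated labels is a linear tree on the subtype of the labels it uses. -/
theorem exists_linear_bind_val (t : BinTree X S) (h : t.leaves.Nodup) :
    ∃ t' : LinTree X {s // s ∈ t.leaves}, (t'.1.bind fun s => leaf s.1) = t := by
  obtain ⟨t', ht'⟩ := t.exists_bind_val (p := (· ∈ t.leaves)) fun _ hs => hs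
  have hl : t'.leaves.map Subtype.val = t.leaves := by
    rw [← leaves_bind_leaf, ht']
  refine ⟨⟨t', List.Nodup.of_map _ (hl ▸ h), fun s => ?_⟩, ht'⟩
  have hs : s.1 ∈ t'.leaves.map Subtype.val := by rw [hl]; exact s.2
  obtain ⟨s', hs', h'⟩ := List.mem_map.1 hs
  rwa [← Subtype.ext h']

/-- The number of vertices of a tree. -/
def size : BinTree X S → ℕ
  | leaf _ => 0
  | node _ l r => l.size + r.size + 1

theorem size_bind_leaf (t : BinTree X S) (f : S → T) :
    (t.bind fun s => leaf (f s)).size = t.size := by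
  induction t with
  | leaf s => rfl
  | node x l r hl hr => simp [bind, size, hl, hr]

/-- The value of a tree in a set with a binary operation for every vertex decoration. -/
def eval {A : Type v} (op : X → A → A → A) : BinTree X S → (S → A) → A
  | leaf s, a => a s
  | node x l r, a => op x (l.eval op a) (r.eval op a)

theorem eval_bind {A : Type v} (op : X → A → A → A) (t : BinTree X S) (f : S → BinTree X T)
    (a : T → A) : (t.bind f).eval op a = t.eval op fun s => (f s).eval op a := by
  induction t with
  | leaf s => rfl
  | node x l r hl hr => simp [bind, eval, hl, hr]

theorem eval_update_of_notMem {A : Type v} (op : X → A → A → A) [DecidableEq S]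
    (t : BinTree X S) (a : S → A) {s : S} (hs : s ∉ t.leaves) (x : A) :
    t.eval op (Function.update a s x) = t.eval op a := by
  induction t with
  | leaf s' => exact Function.update_of_ne (by rintro rfl; simp [leaves] at hs) _ _
  | node y l r hl hr =>
    simp only [leaves, List.mem_append, not_or] at hs
    simp [eval, hl hs.1, hr hs.2]

section Linear

variable {K : Type u} [Field K] {A : Type v} [AddCommGroup A] [Module K A]

/-- The value of a tree without repeated labels is linear in the value of each of its labels. -/
theorem exists_linearMap_eval_update (op : X → A →ₗ[K] A →ₗ[K] A) [DecidableEq S]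
    (t : BinTree X S) (a : S → A) {s : S} (ht : t.leaves.Nodup) (hs : s ∈ t.leaves) :
    ∃ L : A →ₗ[K] A, ∀ x, t.eval (fun y a b => op y a b) (Function.update a s x) = L x := by
  induction t with
  | leaf s' =>
    simp only [leaves, List.mem_singleton] at hs
    subst hs
    exact ⟨LinearMap.id, fun x => by simp [eval]⟩
  | node y l r hl hr =>
    simp only [leaves, List.nodup_append] at ht
    simp only [leaves, List.mem_append] at hs
    rcases hs with hs | hs
    · have hs' : s ∉ r.leaves := fun h => ht.2.2 s hs s h rfl
      obtain ⟨L, hL⟩ := hl ht.1 hs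
      exact ⟨(op y).flip (r.eval (fun y a b => op y a b) a) ∘ₗ L, fun x => by
        simp [eval, eval_update_of_notMem _ r a hs', hL]⟩
    · have hs' : s ∉ l.leaves := fun h => ht.2.2 s h s hs rfl
      obtain ⟨L, hL⟩ := hr ht.2.1 hs
      exact ⟨op y (l.eval (fun y a b => op y a b) a) ∘ₗ L, fun x => by
        simp [eval, eval_update_of_notMem _ l a hs', hL]⟩

end Linear

end BinTree

namespace LinTree

variable {X : Type u} {S T : Type}

theorem map_coe (σ : S ≃ T) (t : LinTree X S) :
    (t.map σ).1 = t.1.bind fun s => .leaf (σ s) := rfl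

theorem comp_coe (t : LinTree X (Option S)) (u : LinTree X T) :
    (t.comp u).1 = t.1.bind (BinTree.graftFun u.1) := rfl

theorem corolla_coe (x : X) : (corolla x).1 = .node x (.leaf 0) (.leaf 1) := rfl

/-- The multilinear operation given by a linear tree. -/
def multilinear {K : Type u} [Field K] {A : Type v} [AddCommGroup A] [Module K A]
    (op : X → A →ₗ[K] A →ₗ[K] A) (t : LinTree X S) : MultilinearMap K (fun _ : S => A) A where
  toFun a := t.1.eval (fun y a b => op y a b) a
  map_update_add' a s x y := by
    obtain ⟨L, hL⟩ := t.1.exists_linearMap_eval_update op a t.2.1 (t.2.2 s)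
    simp only [hL, map_add]
  map_update_smul' a s c x := by
    obtain ⟨L, hL⟩ := t.1.exists_linearMap_eval_update op a t.2.1 (t.2.2 s)
    simp only [hL, map_smul]

/-- Linear trees are generated by the corollas under relabelling and grafting: at a root vertex,
graft the right branch and then the left branch on the corolla. -/
theorem induction {motive : ∀ (S : Type) [Finite S], LinTree X S → Prop}
    (one : motive Unit one) (corolla : ∀ x, motive (Fin 2) (corolla x))
    (map : ∀ {S T : Type} [Finite S] [Finite T] (σ : S ≃ T) (t : LinTree X S),
      motive S t → motive T (t.map σ))
    (comp : ∀ {S T : Type} [Finite S] [Finite T] (t : LinTree X (Option S)) (u : LinTree X T),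
      motive (Option S) t → motive T u → motive (S ⊕ T) (t.comp u))
    {S : Type} [Finite S] (t : LinTree X S) : motive S t := by
  obtain ⟨n, hn⟩ : ∃ n, t.1.size < n := ⟨_, Nat.lt_succ_self _⟩
  induction n generalizing S with
  | zero => omega
  | succ n ih =>
    obtain ⟨t, ht⟩ := t
    cases t with
    | leaf s =>
      have hS : ∀ s', s' = s := fun s' => by simpa [BinTree.leaves] using ht.2 s'
      let σ : Unit ≃ S := ⟨fun _ => s, fun _ => (), fun _ => rfl, fun s' => (hS s').symm⟩
      exact map σ _ one
    | node x l r =>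
      have hnd := ht.1
      have hmem := ht.2
      simp only [BinTree.leaves, List.nodup_append, List.mem_append] at hnd hmem
      obtain ⟨l', hl⟩ := l.exists_linear_bind_val hnd.1
      obtain ⟨r', hr⟩ := r.exists_linear_bind_val hnd.2.1
      have hsl : l'.1.size = l.size := by
        rw [← l'.1.size_bind_leaf Subtype.val, hl]
      have hsr : r'.1.size = r.size := by
        rw [← r'.1.size_bind_leaf Subtype.val, hr]
      simp only [BinTree.size] at hn
      have hL := ih l' (by omega)
      have hR := ih r' (by omega)
      let σ₁ : Fin 2 ≃ Option Unit :=
        ⟨![some (), none], fun o => o.elim 1 fun _ => 0, by decide, by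
          rintro (_ | _) <;> rfl⟩
      let σ₂ (U : Type) : Unit ⊕ U ≃ Option U :=
        ⟨Sum.elim (fun _ => none) some, fun o => o.elim (Sum.inl ()) Sum.inr, by
          rintro (_ | _) <;> rfl, by rintro (_ | _) <;> rfl⟩
      let σ₃ : {s // s ∈ r.leaves} ⊕ {s // s ∈ l.leaves} ≃ S :=
        Equiv.ofBijective (Sum.elim Subtype.val Subtype.val) ⟨by
          rintro (⟨a, ha⟩ | ⟨a, ha⟩) (⟨b, hb⟩ | ⟨b, hb⟩) h
          · simpa using h
          · exact absurd h.symm (hnd.2.2 _ hb _ ha)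
          · exact absurd h (hnd.2.2 _ ha _ hb)
          · simpa using h, fun s => by
          rcases hmem s with h | h
          exacts [⟨Sum.inr ⟨s, h⟩, rfl⟩, ⟨Sum.inl ⟨s, h⟩, rfl⟩]⟩
      have key := map σ₃ _ (comp _ _ (map (σ₂ _) _ (comp _ _ (map σ₁ _ (corolla x)) hR)) hL)
      have heq : (((((LinTree.corolla x).map σ₁).comp r').map (σ₂ _)).comp
          l').map σ₃ = ⟨.node x l r, ht⟩ := by
        refine Subtype.ext ?_
        refine Eq.trans ?_ (congrArg₂ (BinTree.node x) hl hr)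
        simp [LinTree.map_coe, LinTree.comp_coe, LinTree.corolla_coe, BinTree.bind,
          BinTree.bind_bind, BinTree.graftFun, σ₁, σ₂, σ₃]
        exact ⟨rfl, rfl⟩
      rw [← heq]
      exact key

end LinTree

/-! ### The free operad and its algebras -/

section FreeAPI

variable {K : Type u} [Field K] {X : Type u}

/-- The basis element of the free operad given by a linear tree. -/
noncomputable def LinTree.toOperad (K : Type u) [Field K] {S : Type} [Finite S]
    (t : LinTree X S) : (freeOperad K X).obj S :=
  Finsupp.single t (1 : K)

variable {S T : Type} [Finite S] [Finite T]

theorem freeOperad_map_toOperad (σ : S ≃ T) (t : LinTree X S) :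
    (freeOperad K X).map σ (t.toOperad K) = (t.map σ).toOperad K :=
  Finsupp.mapDomain_single

theorem freeOperad_comp_toOperad (t : LinTree X (Option S)) (u : LinTree X T) :
    (freeOperad K X).comp (t.toOperad K) (u.toOperad K) = (t.comp u).toOperad K :=
  (freeComp_single t u 1 1).trans (by rw [mul_one]; rfl)

theorem span_range_toOperad :
    Submodule.span K (Set.range (LinTree.toOperad K : LinTree X S → _)) = ⊤ :=
  (Finsupp.basisSingleOne : Module.Basis (LinTree X S) K (LinTree X S →₀ K)).span_eq

@[elab_as_elim]
theorem freeOperad_induction {motive : (freeOperad K X).obj S → Prop} (p : (freeOperad K X).obj S)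
    (tree : ∀ t : LinTree X S, motive (t.toOperad K))
    (zero : motive 0) (add : ∀ p q, motive p → motive q → motive (p + q))
    (smul : ∀ (c : K) p, motive p → motive (c • p)) : motive p := by
  have hp : p ∈ Submodule.span K (Set.range (LinTree.toOperad K : LinTree X S → _)) :=
    span_range_toOperad (K := K) (X := X) (S := S) ▸ Submodule.mem_top
  induction hp using Submodule.span_induction with
  | mem p hp => obtain ⟨t, rfl⟩ := hp; exact tree t
  | zero => exact zero
  | add p q _ _ hp hq => exact add p q hp hq
  | smul c p _ hp => exact smul c p hp

variable {A : Type v} [AddCommGroup A] [Module K A]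

/-- The action of the free operad on a vector space with bilinear operations. -/
noncomputable def treeAct (op : X → A →ₗ[K] A →ₗ[K] A) :
    (freeOperad K X).obj S →ₗ[K] MultilinearMap K (fun _ : S => A) A :=
  Finsupp.linearCombination K fun t => t.multilinear op

theorem treeAct_toOperad (op : X → A →ₗ[K] A →ₗ[K] A) (t : LinTree X S) (a : S → A) :
    treeAct op (t.toOperad K) a = t.1.eval (fun x a b => op x a b) a :=
  congrArg (fun m : MultilinearMap K (fun _ : S => A) A => m a)
    ((Finsupp.linearCombination_single K (v := fun t : LinTree X S => t.multilinear op)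
      (1 : K) t).trans (one_smul K (t.multilinear op)))

/-- A family of bilinear operations on `A` makes it an algebra over the free operad. -/
noncomputable def treeAlgebra (op : X → A →ₗ[K] A →ₗ[K] A) : (freeOperad K X).Algebra A where
  act := treeAct op
  act_map σ p a := by
    induction p using freeOperad_induction with
    | tree t =>
      rw [freeOperad_map_toOperad, treeAct_toOperad, treeAct_toOperad]
      exact BinTree.eval_bind _ _ _ _
    | zero => simp only [map_zero, zero_apply]
    | add p q hp hq => simp only [map_add, add_apply, hp, hq]
    | smul c p hp => simp only [map_smul, smul_apply, hp]
  act_one a := treeAct_toOperad op LinTree.one a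
  act_comp p q a := by
    induction p using freeOperad_induction with
    | tree t =>
      -- the right-hand side is linear in the value at the grafted input
      have h : IsLinearMap K fun x => treeAct op (t.toOperad K)
          (fun o : Option _ => o.elim x fun s => a (Sum.inl s)) := by
        classical
        have hu : ∀ x, (fun o : Option _ => o.elim x fun s => a (Sum.inl s)) =
            Function.update (fun o : Option _ => o.elim 0 fun s => a (Sum.inl s)) none x := by
          intro x
          funext o
          cases o <;> simp
        refine ⟨fun x y => ?_, fun c x => ?_⟩
        · rw [hu x, hu y, hu (x + y)]
          exact MultilinearMap.map_update_add _ _ _ _ _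
        · rw [hu x, hu (c • x)]
          exact MultilinearMap.map_update_smul _ _ _ _ _
      induction q using freeOperad_induction with
      | tree u =>
        rw [freeOperad_comp_toOperad, treeAct_toOperad, treeAct_toOperad, treeAct_toOperad,
          LinTree.comp_coe, BinTree.eval_bind]
        congr 1
        funext o
        cases o with
        | none => exact BinTree.eval_bind _ _ _ _
        | some s => rfl
      | zero =>
        rw [map_zero, map_zero, map_zero, zero_apply]
        exact ((treeAct op (t.toOperad K)).map_coord_zero none rfl).symm
      | add q r hq hr =>
        rw [map_add, map_add, add_apply, hq, hr, map_add]
        exact (h.map_add _ _).symm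
      | smul c q hq =>
        rw [map_smul, map_smul, smul_apply, hq, map_smul]
        exact (h.map_smul _ _).symm
    | zero => simp only [map_zero, LinearMap.zero_apply, zero_apply]
    | add p q hp hq => simp only [map_add, LinearMap.add_apply, add_apply, hp, hq]
    | smul c p hp => simp only [map_smul, LinearMap.smul_apply, smul_apply, hp]

end FreeAPI

/-! ### Morphisms, quotients and their algebras -/

namespace Operad

variable {K : Type u} [Field K]

section Quotient

variable (P : Operad K) (n : ℕ) (R : Set (P.obj (Fin n))) {S T : Type} [Finite S] [Finite T]

theorem toQuotient_map (σ : S ≃ T) (p : P.obj S) :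
    P.toQuotient n R T (P.map σ p) = (P.quotient n R).map σ (P.toQuotient n R S p) := rfl

theorem toQuotient_comp (p : P.obj (Option S)) (q : P.obj T) :
    P.toQuotient n R (S ⊕ T) (P.comp p q) =
      (P.quotient n R).comp (P.toQuotient n R (Option S) p) (P.toQuotient n R T q) := rfl

theorem toQuotient_one : P.toQuotient n R Unit P.one = (P.quotient n R).one := rfl

theorem toQuotient_surjective (S : Type) [Finite S] :
    Function.Surjective (P.toQuotient n R S) :=
  Submodule.mkQ_surjective _

theorem toQuotient_eq_zero_iff (p : P.obj S) :
    P.toQuotient n R S p = 0 ↔ P.IdealMem n R S p :=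
  Submodule.Quotient.mk_eq_zero _

variable {P n R}

theorem toQuotient_eq_of_sub_mem {p q : P.obj (Fin n)} (h : p - q ∈ R) :
    P.toQuotient n R (Fin n) p = P.toQuotient n R (Fin n) q := by
  rw [← sub_eq_zero, ← map_sub, toQuotient_eq_zero_iff]
  exact .rel _ h

variable {A : Type v} [AddCommGroup A] [Module K A]

theorem Algebra.act_eq_zero (α : P.Algebra A) (h : ∀ r ∈ R, α.act r = 0) {p : P.obj S}
    (hp : P.IdealMem n R S p) : α.act p = 0 := by
  induction hp with
  | rel r hr => exact h r hr
  | zero S => exact map_zero _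
  | add S p q _ _ hp hq => rw [map_add, hp, hq, add_zero]
  | smul S c p _ hp => rw [map_smul, hp, smul_zero]
  | map S T σ p _ hp =>
    ext a
    rw [α.act_map, hp]
    rfl
  | comp_left S T p q _ hp =>
    ext a
    rw [α.act_comp, hp]
    rfl
  | comp_right S T p q _ hq =>
    ext a
    rw [α.act_comp, hq]
    exact (α.act p).map_coord_zero none rfl

/-- An algebra over `P` on which the relations `R` act by zero is an algebra over the quotient
of `P` by `R`. -/
noncomputable def Algebra.quotient (α : P.Algebra A) (h : ∀ r ∈ R, α.act r = 0) :
    (P.quotient n R).Algebra A where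
  act {S} _ := (P.ideal n R S).liftQ α.act fun _ hp => α.act_eq_zero h hp
  act_map σ p a := by
    obtain ⟨p, rfl⟩ := Submodule.mkQ_surjective _ p
    exact α.act_map σ p a
  act_one a := α.act_one a
  act_comp p q a := by
    obtain ⟨p, rfl⟩ := Submodule.mkQ_surjective _ p
    obtain ⟨q, rfl⟩ := Submodule.mkQ_surjective _ q
    exact α.act_comp p q a

end Quotient

/-- Morphisms of operads. -/
structure Hom (P Q : Operad K) where
  toFun : ∀ (S : Type) [Finite S], P.obj S →ₗ[K] Q.obj S
  map : ∀ {S T : Type} [Finite S] [Finite T] (σ : S ≃ T) (p : P.obj S),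
    toFun T (P.map σ p) = Q.map σ (toFun S p)
  one : toFun Unit P.one = Q.one
  comp : ∀ {S T : Type} [Finite S] [Finite T] (p : P.obj (Option S)) (q : P.obj T),
    toFun (S ⊕ T) (P.comp p q) = Q.comp (toFun (Option S) p) (toFun T q)

/-- The projection on a quotient, as a morphism of operads. -/
def quotientHom (P : Operad K) (n : ℕ) (R : Set (P.obj (Fin n))) : P.Hom (P.quotient n R) where
  toFun := P.toQuotient n R
  map := P.toQuotient_map n R
  one := P.toQuotient_one n R
  comp := P.toQuotient_comp n R

namespace Hom

variable {P Q : Operad K}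

/-- Composition of morphisms of operads. -/
def trans {N : Operad K} (f : P.Hom Q) (g : Q.Hom N) : P.Hom N where
  toFun S _ := g.toFun S ∘ₗ f.toFun S
  map σ p := by simp [f.map, g.map]
  one := by simp [f.one, g.one]
  comp p q := by simp [f.comp, g.comp]

/-- A bijective morphism of operads is an isomorphism. -/
noncomputable def toIso (f : P.Hom Q)
    (hf : ∀ (S : Type) [Finite S], Function.Bijective (f.toFun S)) : P.Iso Q where
  equiv S _ := LinearEquiv.ofBijective (f.toFun S) (hf S)
  equiv_map := f.map
  equiv_one := f.one
  equiv_comp := f.comp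

end Hom

namespace Iso

variable {P Q : Operad K} {n : ℕ} {R : Set (P.obj (Fin n))} {R' : Set (Q.obj (Fin n))}

theorem idealMem_equiv (e : P.Iso Q) (h : ∀ r ∈ R, Q.IdealMem n R' (Fin n) (e.equiv _ r))
    {S : Type} [Finite S] {p : P.obj S} (hp : P.IdealMem n R S p) :
    Q.IdealMem n R' S (e.equiv S p) := by
  induction hp with
  | rel r hr => exact h r hr
  | zero S => rw [map_zero]; exact .zero S
  | add S p q _ _ hp hq => rw [map_add]; exact .add S _ _ hp hq
  | smul S c p _ hp => rw [map_smul]; exact .smul S c _ hp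
  | map S T σ p _ hp => rw [e.equiv_map]; exact .map S T σ _ hp
  | comp_left S T p q _ hp => rw [e.equiv_comp]; exact .comp_left S T _ _ hp
  | comp_right S T p q _ hq => rw [e.equiv_comp]; exact .comp_right S T _ _ hq

/-- The inverse of an isomorphism of operads. -/
noncomputable def symm (e : P.Iso Q) : Q.Iso P where
  equiv S _ := (e.equiv S).symm
  equiv_map σ q := by
    rw [LinearEquiv.symm_apply_eq, e.equiv_map, LinearEquiv.apply_symm_apply]
  equiv_one := by rw [LinearEquiv.symm_apply_eq, e.equiv_one]
  equiv_comp p q := by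
    rw [LinearEquiv.symm_apply_eq, e.equiv_comp, LinearEquiv.apply_symm_apply,
      LinearEquiv.apply_symm_apply]

/-- An isomorphism of operads which exchanges the ideals generated by `R` and by `R'` induces an
isomorphism of the quotients. -/
noncomputable def quotient (e : P.Iso Q)
    (h : ∀ r ∈ R, Q.IdealMem n R' (Fin n) (e.equiv _ r))
    (h' : ∀ r ∈ R', P.IdealMem n R (Fin n) ((e.equiv _).symm r)) :
    (P.quotient n R).Iso (Q.quotient n R') where
  equiv S _ := Submodule.Quotient.equiv (P.ideal n R S) (Q.ideal n R' S) (e.equiv S) (by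
    refine le_antisymm (Submodule.map_le_iff_le_comap.2 fun p hp => e.idealMem_equiv h hp) ?_
    intro q hq
    exact ⟨(e.equiv S).symm q, e.symm.idealMem_equiv h' hq, (e.equiv S).apply_symm_apply q⟩)
  equiv_map σ p := by
    obtain ⟨p, rfl⟩ := Submodule.mkQ_surjective _ p
    exact congrArg (Q.ideal n R' _).mkQ (e.equiv_map σ p)
  equiv_one := congrArg (Q.ideal n R' _).mkQ e.equiv_one
  equiv_comp p q := by
    obtain ⟨p, rfl⟩ := Submodule.mkQ_surjective _ p
    obtain ⟨q, rfl⟩ := Submodule.mkQ_surjective _ q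
    exact congrArg (Q.ideal n R' _).mkQ (e.equiv_comp p q)

end Iso

end Operad

/-! ### Change of generators and faithfulness of the action on trees -/

namespace BinTree

variable {X Y : Type u} {S T : Type}

/-- Change of the decorations of the vertices. -/
def vmap (f : X → Y) : BinTree X S → BinTree Y S
  | leaf s => leaf s
  | node x l r => node (f x) (l.vmap f) (r.vmap f)

theorem leaves_vmap (f : X → Y) (t : BinTree X S) : (t.vmap f).leaves = t.leaves := by
  induction t with
  | leaf s => rfl
  | node x l r hl hr => simp [vmap, leaves, hl, hr]

theorem vmap_bind (f : X → Y) (t : BinTree X S) (g : S → BinTree X T) :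
    (t.bind g).vmap f = (t.vmap f).bind fun s => (g s).vmap f := by
  induction t with
  | leaf s => rfl
  | node x l r hl hr => simp [vmap, bind, hl, hr]

theorem eval_vmap {A : Type v} (f : X → Y) (op : Y → A → A → A) (t : BinTree X S) (a : S → A) :
    (t.vmap f).eval op a = t.eval (fun x => op (f x)) a := by
  induction t with
  | leaf s => rfl
  | node x l r hl hr => simp [vmap, eval, hl, hr]

end BinTree

/-- Change of the decorations of the vertices of a linear tree. -/
def LinTree.vmap {X Y : Type u} {S : Type} (f : X → Y) (t : LinTree X S) : LinTree Y S :=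
  ⟨t.1.vmap f, by rw [BinTree.IsLinear, BinTree.leaves_vmap]; exact t.2⟩

/-- The linear extension of the change of decorations to the free operads. -/
noncomputable def freeOperadVmap (K : Type u) [Field K] {X Y : Type u} (f : X → Y) (S : Type)
    [Finite S] : (freeOperad K X).obj S →ₗ[K] (freeOperad K Y).obj S :=
  Finsupp.lmapDomain K K (LinTree.vmap f)

section FreeHom

variable {K : Type u} [Field K] {X Y : Type u}

theorem freeOperadVmap_toOperad (f : X → Y) {S : Type} [Finite S] (t : LinTree X S) :
    freeOperadVmap K f S (t.toOperad K) = (t.vmap f).toOperad K :=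
  Finsupp.mapDomain_single

variable (K) in
/-- The morphism of free operads given by a map between the sets of generators. -/
noncomputable def freeOperadHom (f : X → Y) : (freeOperad K X).Hom (freeOperad K Y) where
  toFun := freeOperadVmap K f
  map σ p := by
    induction p using freeOperad_induction with
    | tree t =>
      rw [freeOperad_map_toOperad, freeOperadVmap_toOperad, freeOperadVmap_toOperad,
        freeOperad_map_toOperad]
      congr 1
      exact Subtype.ext (BinTree.vmap_bind f _ _)
    | zero => simp only [map_zero]
    | add p q hp hq => simp only [map_add, hp, hq]
    | smul c p hp => simp only [map_smul, hp]
  one := freeOperadVmap_toOperad f LinTree.one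
  comp p q := by
    induction p using freeOperad_induction with
    | tree t =>
      induction q using freeOperad_induction with
      | tree u =>
        rw [freeOperad_comp_toOperad, freeOperadVmap_toOperad, freeOperadVmap_toOperad,
          freeOperadVmap_toOperad, freeOperad_comp_toOperad]
        congr 1
        refine Subtype.ext ((BinTree.vmap_bind f _ _).trans (congrArg _ (funext fun o => ?_)))
        cases o with
        | none => exact BinTree.vmap_bind f _ _
        | some s => rfl
      | zero => simp only [map_zero]
      | add p q hp hq => simp only [map_add, hp, hq]
      | smul c p hp => simp only [map_smul, hp]
    | zero => simp only [map_zero, LinearMap.zero_apply]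
    | add p q hp hq => simp only [map_add, LinearMap.add_apply, hp, hq]
    | smul c p hp => simp only [map_smul, LinearMap.smul_apply, hp]

/-- The action of the free operad on `Y` restricts, along a map of generators `X → Y`, to the action
of the free operad on `X` through the pulled-back operations. -/
theorem treeAct_freeOperadVmap {A : Type v} [AddCommGroup A] [Module K A] (f : X → Y)
    (op : Y → A →ₗ[K] A →ₗ[K] A) {S : Type} [Finite S] (p : (freeOperad K X).obj S) (a : S → A) :
    treeAct op (freeOperadVmap K f S p) a = treeAct (fun x => op (f x)) p a := by
  induction p using freeOperad_induction with
  | tree t =>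
    rw [freeOperadVmap_toOperad, treeAct_toOperad, treeAct_toOperad]
    exact BinTree.eval_vmap _ _ _ _
  | zero => simp only [map_zero, zero_apply]
  | add p q hp hq => simp only [map_add, add_apply, hp, hq]
  | smul c p hp => simp only [map_smul, smul_apply, hp]

/-- The free operad acts faithfully on the magmatic algebra spanned by all trees: a linear
combination of linear trees is recovered by evaluating it at the leaves. -/
theorem eq_zero_of_treeAct_eq_zero {S : Type} [Finite S] (p : (freeOperad K X).obj S)
    (h : ∀ (A : Type u) [AddCommGroup A] [Module K A] (op : X → A →ₗ[K] A →ₗ[K] A) (a : S → A),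
      treeAct op p a = 0) : p = 0 := by
  let op (x : X) : (BinTree X S →₀ K) →ₗ[K] (BinTree X S →₀ K) →ₗ[K] (BinTree X S →₀ K) :=
    Finsupp.linearCombination K fun l => Finsupp.lmapDomain K K (BinTree.node x l)
  let a (s : S) : BinTree X S →₀ K := Finsupp.single (.leaf s) 1
  have heval (t : BinTree X S) : t.eval (fun x a b => op x a b) a = Finsupp.single t 1 := by
    induction t with
    | leaf s => rfl
    | node x l r hl hr => simp [BinTree.eval, hl, hr, op]
  have hact (p : (freeOperad K X).obj S) :
      treeAct op p a = Finsupp.lmapDomain K K (Subtype.val : LinTree X S → BinTree X S) p := by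
    induction p using freeOperad_induction with
    | tree t =>
      rw [treeAct_toOperad, heval]
      exact Finsupp.mapDomain_single.symm
    | zero => rw [map_zero, zero_apply]; exact (map_zero _).symm
    | add p q hp hq => rw [map_add, add_apply, hp, hq]; exact (map_add _ _ _).symm
    | smul c p hp => rw [map_smul, smul_apply, hp]; exact (map_smul _ _ _).symm
  have h0 := (hact p).symm.trans (h _ op a)
  exact Finsupp.mapDomain_injective Subtype.val_injective
    (h0.trans (map_zero (Finsupp.lmapDomain K K (Subtype.val : LinTree X S → BinTree X S))).symm)

end FreeHom

/-! ### The free operad on the regular representation -/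

section Combs

theorem nodup_rotate (i : Fin 3) : [i + 1, i + 2, i].Nodup ∧ [i + 2, i + 1, i].Nodup ∧
    [i, i + 1, i + 2].Nodup ∧ [i, i + 2, i + 1].Nodup := by
  revert i
  decide

variable {K : Type u} [Field K]

theorem freeOperad_map_leftComb (σ : Equiv.Perm (Fin 3)) {i j k : Fin 3} (h : [i, j, k].Nodup) :
    (freeOperad K PUnit.{u + 1}).map σ (leftComb K i j k h) =
      leftComb K (σ i) (σ j) (σ k) (h.map σ.injective) :=
  freeOperad_map_toOperad σ _

theorem freeOperad_map_rightComb (σ : Equiv.Perm (Fin 3)) {i j k : Fin 3}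
    (h : [i, j, k].Nodup) :
    (freeOperad K PUnit.{u + 1}).map σ (rightComb K i j k h) =
      rightComb K (σ i) (σ j) (σ k) (h.map σ.injective) :=
  freeOperad_map_toOperad σ _

end Combs

namespace QuadraticData

variable {K : Type u} [Field K] (D : QuadraticData K)

theorem gen_swap (e : D.E) :
    D.gen (D.swap e) = D.free.map (Equiv.swap (0 : Fin 2) 1) (D.gen e) :=
  Operad.toQuotient_eq_of_sub_mem (R := D.linearRelations) (Or.inr ⟨e, rfl⟩)

theorem compAt_apply (i : Fin 3) (e f : D.E) :
    D.compAt i e f = D.free.map (Equiv.addLeft i) (D.free.map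
      (finSumFinEquiv : Fin 1 ⊕ Fin 2 ≃ Fin 3)
        (D.free.comp (D.free.map (finSuccEquiv 1) (D.gen e)) (D.gen f))) := rfl

theorem toFree_single (i : Fin 3) (e f : D.E) :
    D.toFree (Pi.single i (e ⊗ₜ f)) = D.compAt i e f := by
  rw [toFree, LinearMap.sum_apply, Finset.sum_eq_single i]
  · simp
  · intro j _ hj
    simp [Pi.single_eq_of_ne hj]
  · simp

/-- The morphism from the free operad on one binary operation which sends this operation to the
generator `e`. -/
noncomputable def ofGen (e : D.E) : (freeOperad K PUnit.{u + 1}).Hom D.free :=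
  (freeOperadHom K fun _ => e).trans (Operad.quotientHom _ 2 D.linearRelations)

theorem ofGen_corolla (e : D.E) :
    (D.ofGen e).toFun (Fin 2) ((LinTree.corolla .unit).toOperad K) = D.gen e :=
  congrArg ((freeOperad K D.E).toQuotient 2 D.linearRelations (Fin 2))
    (freeOperadVmap_toOperad (fun _ => e) (LinTree.corolla PUnit.unit))

variable {D} (b : Module.Basis (Fin 2) K D.E) (hb : D.swap (b 0) = b 1)

include hb

theorem ofGen_corolla_swap :
    (D.ofGen (b 0)).toFun (Fin 2) ((freeOperad K PUnit.{u + 1}).map (Equiv.swap (0 : Fin 2) 1)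
      ((LinTree.corolla .unit).toOperad K)) = D.gen (b 1) := by
  rw [(D.ofGen (b 0)).map, ofGen_corolla, ← gen_swap, hb]

theorem ofGen_surjective (S : Type) [Finite S] :
    Function.Surjective ((D.ofGen (b 0)).toFun S) := by
  have htree (S : Type) [Finite S] (t : LinTree D.E S) :
      (freeOperad K D.E).toQuotient 2 D.linearRelations S (t.toOperad K) ∈
        LinearMap.range ((D.ofGen (b 0)).toFun S) := by
    refine LinTree.induction (motive := fun S _ t => (freeOperad K D.E).toQuotient 2
      D.linearRelations S (t.toOperad K) ∈ LinearMap.range ((D.ofGen (b 0)).toFun S))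
      ?_ ?_ ?_ ?_ t
    · exact ⟨_, (D.ofGen (b 0)).one⟩
    · intro e
      change D.gen e ∈ _
      rw [← b.sum_repr e, Fin.sum_univ_two, map_add, map_smul, map_smul]
      exact add_mem (Submodule.smul_mem _ _ ⟨_, ofGen_corolla D (b 0)⟩)
        (Submodule.smul_mem _ _ ⟨_, ofGen_corolla_swap b hb⟩)
    · rintro S T _ _ σ t ⟨p, hp⟩
      refine ⟨(freeOperad K PUnit.{u + 1}).map σ p, ?_⟩
      rw [(D.ofGen (b 0)).map, hp, ← freeOperad_map_toOperad]
      rfl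
    · rintro S T _ _ t u ⟨p, hp⟩ ⟨q, hq⟩
      refine ⟨(freeOperad K PUnit.{u + 1}).comp p q, ?_⟩
      rw [(D.ofGen (b 0)).comp, hp, hq, ← freeOperad_comp_toOperad]
      rfl
  intro x
  obtain ⟨p, rfl⟩ := (freeOperad K D.E).toQuotient_surjective 2 D.linearRelations S x
  change _ ∈ LinearMap.range ((D.ofGen (b 0)).toFun S)
  induction p using freeOperad_induction with
  | tree t => exact htree S t
  | zero => rw [LinearMap.map_zero]; exact zero_mem _
  | add p q hp hq => rw [map_add]; exact add_mem hp hq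
  | smul c p hp => rw [map_smul]; exact Submodule.smul_mem _ c hp

/-- The free operad on the regular representation acts on every vector space with a bilinear
operation, the second generator being the opposite operation. As the free operad on one operation
acts faithfully on such spaces, it embeds. -/
theorem ofGen_injective (S : Type) [Finite S] :
    Function.Injective ((D.ofGen (b 0)).toFun S) := by
  rw [injective_iff_map_eq_zero]
  intro p hp
  refine eq_zero_of_treeAct_eq_zero p fun A _ _ op a => ?_
  let opE : D.E →ₗ[K] A →ₗ[K] A →ₗ[K] A := b.constr K ![op .unit, (op .unit).flip]
  have hop0 : opE (b 0) = op .unit := b.constr_basis K _ 0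
  have hop1 : opE (b 1) = (op .unit).flip := b.constr_basis K _ 1
  have hswap : opE ∘ₗ D.swap = LinearMap.lflip.toLinearMap ∘ₗ opE := by
    refine b.ext fun i => ?_
    fin_cases i
    · simp [hb, hop0, hop1]
    · change opE (D.swap (b 1)) = (opE (b 1)).flip
      rw [← hb, D.swap_swap, hb, hop0, hop1, LinearMap.flip_flip]
  have hgen (e : D.E) (a : Fin 2 → A) : treeAct opE (D.preGen e) a = opE e (a 0) (a 1) :=
    treeAct_toOperad opE (LinTree.corolla e) a
  have hrel : ∀ r ∈ D.linearRelations, (treeAlgebra opE).act r = 0 := by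
    intro r hr
    ext a
    change treeAct opE r a = 0
    rcases hr with (⟨e, f, rfl⟩ | ⟨c, e, rfl⟩) | ⟨e, rfl⟩
    · simp only [map_sub, map_add, sub_apply, add_apply, hgen, LinearMap.add_apply, sub_self]
    · simp only [map_sub, map_smul, sub_apply, smul_apply, hgen, LinearMap.smul_apply, sub_self]
    · have h := (treeAlgebra opE).act_map (Equiv.swap (0 : Fin 2) 1) (D.preGen e) a
      change treeAct opE _ a = treeAct opE _ _ at h
      rw [map_sub, sub_apply, h, hgen, hgen, sub_eq_zero]
      exact congrArg (fun L => L (a 0) (a 1)) (LinearMap.congr_fun hswap e)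
  have hact : ((treeAlgebra opE).quotient hrel).act ((D.ofGen (b 0)).toFun S p) a =
      treeAct (fun _ => opE (b 0)) p a := treeAct_freeOperadVmap (fun _ => b 0) opE p a
  rw [hop0] at hact
  rw [← show _ = treeAct op p a from hact]
  exact (congrArg (fun q => ((treeAlgebra opE).quotient hrel).act q a) hp).trans
    (congrArg (fun m : MultilinearMap K (fun _ : S => A) A => m a)
      (LinearMap.map_zero ((treeAlgebra opE).quotient hrel).act))

/-- The free operad on one binary operation is the free operad on the regular representation
of the symmetric group on two letters. -/
noncomputable def freeIso :
    (freeOperad K PUnit.{u + 1}).Iso D.free :=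
  (D.ofGen (b 0)).toIso fun S _ => ⟨ofGen_injective b hb S, ofGen_surjective b hb S⟩

omit hb in
theorem compAt_eq (φ : (freeOperad K PUnit.{u + 1}).Iso D.free) {e f : D.E}
    {t v : LinTree PUnit.{u + 1} (Fin 2)} (ht : φ.equiv _ (t.toOperad K) = D.gen e)
    (hv : φ.equiv _ (v.toOperad K) = D.gen f) (i : Fin 3) :
    D.compAt i e f = φ.equiv _ (((((t.map (finSuccEquiv 1)).comp v).map
      (finSumFinEquiv : Fin 1 ⊕ Fin 2 ≃ Fin 3)).map (Equiv.addLeft i)).toOperad K) := by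
  rw [compAt_apply, ← ht, ← hv, ← φ.equiv_map, ← φ.equiv_comp, ← φ.equiv_map, ← φ.equiv_map,
    freeOperad_map_toOperad, freeOperad_comp_toOperad, freeOperad_map_toOperad,
    freeOperad_map_toOperad]

theorem freeIso_corolla :
    (freeIso b hb).equiv _ ((LinTree.corolla .unit).toOperad K) = D.gen (b 0) :=
  D.ofGen_corolla (b 0)

theorem freeIso_corolla_swap : (freeIso b hb).equiv _
    (((LinTree.corolla .unit).map (Equiv.swap (0 : Fin 2) 1)).toOperad K) = D.gen (b 1) := by
  rw [← freeOperad_map_toOperad]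
  exact ofGen_corolla_swap b hb

theorem compAt_zero_zero (i : Fin 3) : D.compAt i (b 0) (b 0) =
    (freeIso b hb).equiv _ (leftComb K (i + 1) (i + 2) i (nodup_rotate i).1) := by
  rw [compAt_eq _ (freeIso_corolla b hb) (freeIso_corolla b hb)]
  refine congrArg ((freeIso b hb).equiv (Fin 3)) (congrArg (LinTree.toOperad K) (Subtype.ext ?_))
  fin_cases i <;> rfl

theorem compAt_zero_one (i : Fin 3) : D.compAt i (b 0) (b 1) =
    (freeIso b hb).equiv _ (leftComb K (i + 2) (i + 1) i (nodup_rotate i).2.1) := by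
  rw [compAt_eq _ (freeIso_corolla b hb) (freeIso_corolla_swap b hb)]
  refine congrArg ((freeIso b hb).equiv (Fin 3)) (congrArg (LinTree.toOperad K) (Subtype.ext ?_))
  fin_cases i <;> rfl

theorem compAt_one_zero (i : Fin 3) : D.compAt i (b 1) (b 0) =
    (freeIso b hb).equiv _ (rightComb K i (i + 1) (i + 2) (nodup_rotate i).2.2.1) := by
  rw [compAt_eq _ (freeIso_corolla_swap b hb) (freeIso_corolla b hb)]
  refine congrArg ((freeIso b hb).equiv (Fin 3)) (congrArg (LinTree.toOperad K) (Subtype.ext ?_))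
  fin_cases i <;> rfl

theorem compAt_one_one (i : Fin 3) : D.compAt i (b 1) (b 1) =
    (freeIso b hb).equiv _ (rightComb K i (i + 2) (i + 1) (nodup_rotate i).2.2.2) := by
  rw [compAt_eq _ (freeIso_corolla_swap b hb) (freeIso_corolla_swap b hb)]
  refine congrArg ((freeIso b hb).equiv (Fin 3)) (congrArg (LinTree.toOperad K) (Subtype.ext ?_))
  fin_cases i <;> rfl

/-- The operation of arity three with given coordinates, as a combination of combs. -/
theorem freeIso_symm_toFree (w : Fin 3 → D.E ⊗[K] D.E)
    (c : Fin 3 → Fin 2 → Fin 2 → K)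
    (hw : ∀ i, w i = ∑ j, ∑ k, c i j k • (b j ⊗ₜ[K] b k)) :
    ((freeIso b hb).equiv _).symm (D.toFree w) = ∑ i,
      (c i 0 0 • leftComb K (i + 1) (i + 2) i (nodup_rotate i).1 +
        c i 0 1 • leftComb K (i + 2) (i + 1) i (nodup_rotate i).2.1 +
        (c i 1 0 • rightComb K i (i + 1) (i + 2) (nodup_rotate i).2.2.1 +
          c i 1 1 • rightComb K i (i + 2) (i + 1) (nodup_rotate i).2.2.2)) := by
  rw [LinearEquiv.symm_apply_eq, map_sum, toFree, LinearMap.sum_apply]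
  refine Finset.sum_congr rfl fun i _ => ?_
  rw [LinearMap.comp_apply, LinearMap.proj_apply, hw i]
  simp only [Fin.sum_univ_two, map_add, map_smul, TensorProduct.lift.tmul,
    compAt_zero_zero b hb, compAt_zero_one b hb, compAt_one_zero b hb, compAt_one_one b hb]

end QuadraticData

/-! ### The Ginzburg–Kapranov dual of `NAP` -/

section Relations

variable {K : Type u} [Field K] (R : Set ((freeOperad K PUnit.{u + 1}).obj (Fin 3)))

/-- If `(x₀ ≺ x₁) ≺ x₂ = (x₀ ≺ x₂) ≺ x₁` modulo `R`, so are all its relabellings. -/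
theorem toQuotient_leftComb_comm
    (hR : leftComb K 0 1 2 (by decide) - leftComb K 0 2 1 (by decide) ∈ R) {i j k : Fin 3}
    (h : [i, j, k].Nodup) (h' : [i, k, j].Nodup) :
    (freeOperad K PUnit.{u + 1}).toQuotient 3 R (Fin 3) (leftComb K i j k h) =
      (freeOperad K PUnit.{u + 1}).toQuotient 3 R (Fin 3) (leftComb K i k j h') := by
  obtain ⟨σ, rfl, rfl, rfl⟩ : ∃ σ : Equiv.Perm (Fin 3), σ 0 = i ∧ σ 1 = j ∧ σ 2 = k := by
    revert i j k
    decide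
  rw [← freeOperad_map_leftComb σ (by decide : [(0 : Fin 3), 1, 2].Nodup),
    ← freeOperad_map_leftComb σ (by decide : [(0 : Fin 3), 2, 1].Nodup), Operad.toQuotient_map,
    Operad.toQuotient_map, Operad.toQuotient_eq_of_sub_mem hR]

/-- If `x₀ ≺ (x₁ ≺ x₂) = 0` modulo `R`, so are all its relabellings. -/
theorem toQuotient_rightComb (hR : rightComb K 0 1 2 (by decide) ∈ R) {i j k : Fin 3}
    (h : [i, j, k].Nodup) :
    (freeOperad K PUnit.{u + 1}).toQuotient 3 R (Fin 3) (rightComb K i j k h) = 0 := by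
  obtain ⟨σ, rfl, rfl, rfl⟩ : ∃ σ : Equiv.Perm (Fin 3), σ 0 = i ∧ σ 1 = j ∧ σ 2 = k := by
    revert i j k
    decide
  rw [← freeOperad_map_rightComb σ (by decide : [(0 : Fin 3), 1, 2].Nodup), Operad.toQuotient_map,
    (Operad.toQuotient_eq_zero_iff _ 3 R _).2 (.rel _ hR), map_zero]

theorem sum_leftComb_eq_zero
    (hR : leftComb K 0 1 2 (by decide) - leftComb K 0 2 1 (by decide) ∈ R) (c d : Fin 3 → K)
    (h : ∀ i, c (i + 1) + d i = 0) :
    (freeOperad K PUnit.{u + 1}).toQuotient 3 R (Fin 3) (∑ i,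
      (c i • leftComb K (i + 1) (i + 2) i (nodup_rotate i).1 +
        d i • leftComb K (i + 2) (i + 1) i (nodup_rotate i).2.1)) = 0 := by
  have h0 : d 0 = -c 1 := eq_neg_of_add_eq_zero_right (h 0)
  have h1 : d 1 = -c 2 := eq_neg_of_add_eq_zero_right (h 1)
  have h2 : d 2 = -c 0 := eq_neg_of_add_eq_zero_right (h 2)
  simp only [Fin.sum_univ_three, map_add, map_smul, h0, h1, h2]
  have e0 := toQuotient_leftComb_comm R hR (i := 0) (j := 1) (k := 2) (by decide) (by decide)
  have e1 := toQuotient_leftComb_comm R hR (i := 1) (j := 2) (k := 0) (by decide) (by decide)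
  have e2 := toQuotient_leftComb_comm R hR (i := 2) (j := 0) (k := 1) (by decide) (by decide)
  change c 0 • (freeOperad K PUnit.{u + 1}).toQuotient 3 R (Fin 3) (leftComb K 1 2 0 _) +
    -c 1 • (freeOperad K PUnit.{u + 1}).toQuotient 3 R (Fin 3) (leftComb K 2 1 0 _) +
    (c 1 • (freeOperad K PUnit.{u + 1}).toQuotient 3 R (Fin 3) (leftComb K 2 0 1 _) +
    -c 2 • (freeOperad K PUnit.{u + 1}).toQuotient 3 R (Fin 3) (leftComb K 0 2 1 _)) +
    (c 2 • (freeOperad K PUnit.{u + 1}).toQuotient 3 R (Fin 3) (leftComb K 0 1 2 _) +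
    -c 0 • (freeOperad K PUnit.{u + 1}).toQuotient 3 R (Fin 3) (leftComb K 1 0 2 _)) = 0
  rw [e0, e1, e2]
  module

end Relations

namespace QuadraticData

variable {K : Type u} [Field K] {D : QuadraticData K} (b : Module.Basis (Fin 2) K D.E)
  (hb : D.swap (b 0) = b 1)

theorem exists_coordinates (w : D.E ⊗[K] D.E) :
    ∃ c : Fin 2 → Fin 2 → K, w = ∑ j, ∑ k, c j k • (b j ⊗ₜ[K] b k) := by
  refine ⟨fun j k => (b.tensorProduct b).repr w (j, k), ?_⟩
  conv_lhs => rw [← (b.tensorProduct b).sum_repr w]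
  rw [Fintype.sum_prod_type]
  simp [Module.Basis.tensorProduct_apply]

/-- A presentation by one binary operation, compared with quadratic data on the regular
representation. -/
theorem nonempty_iso_operad {R : Set ((freeOperad K PUnit.{u + 1}).obj (Fin 3))}
    (h : ∀ r ∈ R, ∃ w ∈ D.rel, ((freeIso b hb).equiv _).symm (D.toFree w) = r)
    (h' : ∀ w ∈ D.rel, (freeOperad K PUnit.{u + 1}).toQuotient 3 R (Fin 3)
      (((freeIso b hb).equiv _).symm (D.toFree w)) = 0) :
    Nonempty (((freeOperad K PUnit.{u + 1}).quotient 3 R).Iso D.operad) := by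
  refine ⟨(freeIso b hb).quotient ?_ ?_⟩
  · intro r hr
    obtain ⟨w, hw, rfl⟩ := h r hr
    rw [LinearEquiv.apply_symm_apply]
    exact .rel _ ⟨w, hw, rfl⟩
  · rintro _ ⟨w, hw, rfl⟩
    exact (Operad.toQuotient_eq_zero_iff _ 3 R _).1 (h' w hw)

include hb in
theorem freeIso_symm_toFree_single (i : Fin 3) :
    ((freeIso b hb).equiv _).symm (D.toFree (Pi.single i (b 0 ⊗ₜ b 0))) =
      leftComb K (i + 1) (i + 2) i (nodup_rotate i).1 ∧
    ((freeIso b hb).equiv _).symm (D.toFree (Pi.single i (b 0 ⊗ₜ b 1))) =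
      leftComb K (i + 2) (i + 1) i (nodup_rotate i).2.1 ∧
    ((freeIso b hb).equiv _).symm (D.toFree (Pi.single i (b 1 ⊗ₜ b 0))) =
      rightComb K i (i + 1) (i + 2) (nodup_rotate i).2.2.1 := by
  simp only [toFree_single, LinearEquiv.symm_apply_eq]
  exact ⟨compAt_zero_zero b hb i, compAt_zero_one b hb i, compAt_one_zero b hb i⟩

end QuadraticData

section Coordinates

variable {K : Type u} [Field K] {E : Type u} [AddCommGroup E] [Module K E]
  (b : Module.Basis (Fin 2) K E)

/-- The coordinate of `b j ⊗ b k` on `E ⊗ E`. -/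
noncomputable def coordPair (j k : Fin 2) : Module.Dual K (E ⊗[K] E) :=
  TensorProduct.dualDistrib K E E (b.coord j ⊗ₜ b.coord k)

theorem coordPair_basis (j k j' k' : Fin 2) :
    coordPair b j k (b j' ⊗ₜ b k') = (if j' = j then 1 else 0) * (if k' = k then 1 else 0) := by
  simp [coordPair, Finsupp.single_apply]

theorem coordPair_sum (c : Fin 2 → Fin 2 → K) (j k : Fin 2) :
    coordPair b j k (∑ j', ∑ k', c j' k' • (b j' ⊗ₜ[K] b k')) = c j k := by
  simp [coordPair_basis]
  fin_cases j <;> fin_cases k <;> simp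

theorem coordPair_single (i m : Fin 3) (j k : Fin 2) (w : E ⊗[K] E) :
    coordPair b j k ((Pi.single i w : Fin 3 → E ⊗[K] E) m) =
      if m = i then coordPair b j k w else 0 := by
  rw [Pi.single_apply]
  split_ifs
  exacts [rfl, map_zero _]

theorem coordPair_lTensor (s : E →ₗ[K] E)
    (hs : ∀ k e, b.coord k (s e) = b.coord (Equiv.swap 0 1 k) e) (j k : Fin 2) (w : E ⊗[K] E) :
    coordPair b j k (LinearMap.lTensor _ s w) = coordPair b j (Equiv.swap 0 1 k) w := by
  induction w using TensorProduct.induction_on with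
  | zero => simp
  | add w w' h h' => simp only [map_add, h, h']
  | tmul e f =>
    simp only [coordPair, LinearMap.lTensor_tmul, TensorProduct.dualDistrib_apply, hs]

end Coordinates

section NAP

variable (K : Type u) [Field K]

/-- The quadratic data of `NAP`. The generators are `e₀ = x₀ ≺ x₁` and `e₁ = x₁ ≺ x₀`, and the
relations are spanned by the three relabellings
`e₀ (e₀ (x_{i+2}, x_i), x_{i+1}) - e₀ (e₁ (x_{i+1}, x_{i+2}), x_i)` of the relation of `NAP`. They
are encoded as the common zeros of nine coordinate functionals. -/
noncomputable def napData : QuadraticData K where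
  E := Fin 2 → K
  swap := LinearMap.funLeft K K (Equiv.swap 0 1)
  swap_swap e := by
    ext i
    simp [LinearMap.funLeft]
  rel :=
    { carrier := {w | (∀ i k, coordPair (Pi.basisFun K (Fin 2)) 1 k (w i) = 0) ∧
        ∀ i, coordPair (Pi.basisFun K (Fin 2)) 0 0 (w (i + 1)) +
          coordPair (Pi.basisFun K (Fin 2)) 0 1 (w i) = 0}
      add_mem' := fun {w w'} hw hw' => ⟨fun i k => by simp [hw.1, hw'.1], fun i => by
        have h := hw.2 i
        have h' := hw'.2 i
        simp only [Pi.add_apply, map_add]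
        linear_combination h + h'⟩
      zero_mem' := by simp
      smul_mem' := fun c w hw => ⟨fun i k => by simp [hw.1], fun i => by
        have h := hw.2 i
        simp only [Pi.smul_apply, map_smul, smul_eq_mul]
        linear_combination c * h⟩ }
  rel_stable σ w hw := by
    have hswap (j k : Fin 2) (w : (Fin 2 → K) ⊗[K] (Fin 2 → K)) :=
      coordPair_lTensor (Pi.basisFun K (Fin 2)) (LinearMap.funLeft K K (Equiv.swap 0 1))
        (fun _ _ => rfl) j k w
    by_cases hs : Equiv.Perm.sign σ = 1
    · have hσ : ∀ σ : Equiv.Perm (Fin 3), Equiv.Perm.sign σ = 1 →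
          ∀ i, σ.symm (i + 1) = σ.symm i + 1 := by decide
      simp only [hs, if_true]
      refine ⟨fun i k => hw.1 _ k, fun i => ?_⟩
      simp only [hσ σ hs]
      exact hw.2 _
    · have hσ : ∀ σ : Equiv.Perm (Fin 3), Equiv.Perm.sign σ ≠ 1 →
          ∀ i, σ.symm i = σ.symm (i + 1) + 1 := by decide
      simp only [hs, if_false]
      refine ⟨fun i k => (hswap _ _ _).trans (hw.1 _ _), fun i => ?_⟩
      simp only [hswap]
      rw [hσ σ hs i, add_comm]
      exact hw.2 _

/-- The two generators `e₀, e₁` of `NAP`. -/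
noncomputable def napBasis : Module.Basis (Fin 2) K (napData K).E := Pi.basisFun K (Fin 2)

theorem mem_napData_rel (w : Fin 3 → (napData K).E ⊗[K] (napData K).E) :
    w ∈ (napData K).rel ↔ (∀ i k, coordPair (napBasis K) 1 k (w i) = 0) ∧
      ∀ i, coordPair (napBasis K) 0 0 (w (i + 1)) + coordPair (napBasis K) 0 1 (w i) = 0 :=
  Iff.rfl

theorem swap_napBasis : (napData K).swap (napBasis K 0) = napBasis K 1 := by
  change LinearMap.funLeft K K (Equiv.swap 0 1) (Pi.basisFun K (Fin 2) 0) =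
    Pi.basisFun K (Fin 2) 1
  ext i
  fin_cases i <;> simp [LinearMap.funLeft]

theorem nap_rel_mem (i : Fin 3) : (Pi.single (i + 1) (napBasis K 0 ⊗ₜ[K] napBasis K 0) -
    Pi.single i (napBasis K 0 ⊗ₜ[K] napBasis K 1) :
      Fin 3 → (napData K).E ⊗[K] (napData K).E) ∈ (napData K).rel := by
  rw [mem_napData_rel]
  refine ⟨fun j k => ?_, fun j => ?_⟩ <;>
    simp [coordPair_single, coordPair_basis]

theorem nap_iso : Nonempty ((NAP K).Iso (napData K).operad) := by
  refine QuadraticData.nonempty_iso_operad (napBasis K) (swap_napBasis K) ?_ ?_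
  · rintro _ rfl
    refine ⟨_, nap_rel_mem K 1, ?_⟩
    rw [map_sub, map_sub,
      (QuadraticData.freeIso_symm_toFree_single (napBasis K) (swap_napBasis K) (1 + 1)).1,
      (QuadraticData.freeIso_symm_toFree_single (napBasis K) (swap_napBasis K) 1).2.1]
    rfl
  · intro w hw
    choose c hc using fun i => QuadraticData.exists_coordinates (napBasis K) (w i)
    rw [mem_napData_rel] at hw
    simp only [hc, coordPair_sum] at hw
    rw [QuadraticData.freeIso_symm_toFree (napBasis K) (swap_napBasis K) w c hc]
    simp only [hw.1, zero_smul, add_zero]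
    exact sum_leftComb_eq_zero {_} rfl (fun i => c i 0 0) (fun i => c i 0 1) hw.2

end NAP

namespace QuadraticData

variable {K : Type u} [Field K] (D : QuadraticData K)

/-- The generators of the dual data are the linear forms on the generators. -/
def dualEquiv : D.dual.E ≃ₗ[K] Module.Dual K D.E := LinearEquiv.refl K (Module.Dual K D.E)

theorem dualEquiv_swap (φ : D.dual.E) (e : D.E) :
    D.dualEquiv (D.dual.swap φ) e = -D.dualEquiv φ (D.swap e) := rfl

/-- The pairing of `E^∨ ⊗ E^∨` with `E ⊗ E`. -/
noncomputable def dualPairing : D.dual.E ⊗[K] D.dual.E →ₗ[K] Module.Dual K (D.E ⊗[K] D.E) :=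
  TensorProduct.dualDistrib K D.E D.E

theorem dualPairing_tmul (φ ψ : D.dual.E) (w : D.E ⊗[K] D.E) :
    D.dualPairing (φ ⊗ₜ ψ) w =
      TensorProduct.dualDistrib K D.E D.E (D.dualEquiv φ ⊗ₜ D.dualEquiv ψ) w := rfl

theorem mem_dual_rel (φ : Fin 3 → D.dual.E ⊗[K] D.dual.E) :
    φ ∈ D.dual.rel ↔ ∀ w ∈ D.rel, ∑ i, D.dualPairing (φ i) (w i) = 0 := Iff.rfl

theorem sum_dualPairing_single_left (i : Fin 3) (φ : D.dual.E ⊗[K] D.dual.E)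
    (w : Fin 3 → D.E ⊗[K] D.E) :
    ∑ j, D.dualPairing ((Pi.single i φ : Fin 3 → D.dual.E ⊗[K] D.dual.E) j) (w j) =
      D.dualPairing φ (w i) := by
  rw [Finset.sum_eq_single i]
  · rw [Pi.single_eq_same]
  · intro j _ hj
    rw [Pi.single_eq_of_ne hj, map_zero, LinearMap.zero_apply]
  · simp

theorem sum_dualPairing_single_right (i : Fin 3) (φ : Fin 3 → D.dual.E ⊗[K] D.dual.E)
    (w : D.E ⊗[K] D.E) :
    ∑ j, D.dualPairing (φ j) ((Pi.single i w : Fin 3 → D.E ⊗[K] D.E) j) =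
      D.dualPairing (φ i) w := by
  rw [Finset.sum_eq_single i]
  · rw [Pi.single_eq_same]
  · intro j _ hj
    rw [Pi.single_eq_of_ne hj, map_zero]
  · simp

end QuadraticData

section Dual

variable (K : Type u) [Field K]

/-- The generators `e₀* = x₀ ≺ x₁` and `-e₁* = x₁ ≺ x₀` of the dual of `NAP`; the sign comes from
the twist of `E*` by the signature. -/
noncomputable def napDualBasis : Module.Basis (Fin 2) K (napData K).dual.E :=
  ((napBasis K).dualBasis.unitsSMul ![1, -1]).map (napData K).dualEquiv.symm

theorem dualEquiv_napDualBasis_zero :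
    (napData K).dualEquiv (napDualBasis K 0) = (napBasis K).coord 0 := by
  rw [napDualBasis, Module.Basis.map_apply, LinearEquiv.apply_symm_apply,
    Module.Basis.unitsSMul_apply, Module.Basis.coe_dualBasis]
  exact one_smul K _

theorem dualEquiv_napDualBasis_one :
    (napData K).dualEquiv (napDualBasis K 1) = -(napBasis K).coord 1 := by
  rw [napDualBasis, Module.Basis.map_apply, LinearEquiv.apply_symm_apply,
    Module.Basis.unitsSMul_apply, Module.Basis.coe_dualBasis]
  exact neg_one_smul K ((napBasis K).coord 1)

theorem swap_napDualBasis : (napData K).dual.swap (napDualBasis K 0) = napDualBasis K 1 := by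
  refine (napData K).dualEquiv.injective (LinearMap.ext fun e => ?_)
  rw [QuadraticData.dualEquiv_swap, dualEquiv_napDualBasis_zero, dualEquiv_napDualBasis_one]
  rfl

theorem dualPairing_napDualBasis (w : (napData K).E ⊗[K] (napData K).E) :
    (napData K).dualPairing (napDualBasis K 0 ⊗ₜ napDualBasis K 0) w =
      coordPair (napBasis K) 0 0 w ∧
    (napData K).dualPairing (napDualBasis K 0 ⊗ₜ napDualBasis K 1) w =
      -coordPair (napBasis K) 0 1 w ∧
    (napData K).dualPairing (napDualBasis K 1 ⊗ₜ napDualBasis K 0) w =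
      -coordPair (napBasis K) 1 0 w ∧
    (napData K).dualPairing (napDualBasis K 1 ⊗ₜ napDualBasis K 1) w =
      coordPair (napBasis K) 1 1 w := by
  have hl (φ ψ : Module.Dual K (napData K).E) : TensorProduct.dualDistrib K _ _ ((-φ) ⊗ₜ ψ) =
      -TensorProduct.dualDistrib K _ _ (φ ⊗ₜ ψ) :=
    TensorProduct.ext' fun e f => neg_mul (φ e) (ψ f)
  have hr (φ ψ : Module.Dual K (napData K).E) : TensorProduct.dualDistrib K _ _ (φ ⊗ₜ (-ψ)) =
      -TensorProduct.dualDistrib K _ _ (φ ⊗ₜ ψ) :=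
    TensorProduct.ext' fun e f => mul_neg (φ e) (ψ f)
  simp only [QuadraticData.dualPairing_tmul, dualEquiv_napDualBasis_zero,
    dualEquiv_napDualBasis_one, hl, hr, neg_neg, LinearMap.neg_apply, coordPair, and_self]

theorem napDual_rel_mem (i : Fin 3) :
    (Pi.single (i + 1) (napDualBasis K 0 ⊗ₜ[K] napDualBasis K 0) -
      Pi.single i (napDualBasis K 0 ⊗ₜ[K] napDualBasis K 1) :
        Fin 3 → (napData K).dual.E ⊗[K] (napData K).dual.E) ∈ (napData K).dual.rel ∧
    (Pi.single i (napDualBasis K 1 ⊗ₜ[K] napDualBasis K 0) :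
        Fin 3 → (napData K).dual.E ⊗[K] (napData K).dual.E) ∈ (napData K).dual.rel := by
  simp only [QuadraticData.mem_dual_rel]
  refine ⟨fun w hw => ?_, fun w hw => ?_⟩
  · simp only [Pi.sub_apply, map_sub, LinearMap.sub_apply, Finset.sum_sub_distrib,
      QuadraticData.sum_dualPairing_single_left, dualPairing_napDualBasis, sub_neg_eq_add]
    exact hw.2 i
  · rw [QuadraticData.sum_dualPairing_single_left, (dualPairing_napDualBasis K _).2.2.1,
      neg_eq_zero]
    exact hw.1 i 0

/-- In the coordinates of `napDualBasis`, the relations of the dual of `NAP` satisfy the equations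
dual to the relations of `NAP`. -/
theorem coordinates_of_mem_dual_rel {φ : Fin 3 → (napData K).dual.E ⊗[K] (napData K).dual.E}
    (hφ : φ ∈ (napData K).dual.rel) (c : Fin 3 → Fin 2 → Fin 2 → K)
    (hc : ∀ i, φ i = ∑ j, ∑ k, c i j k • (napDualBasis K j ⊗ₜ[K] napDualBasis K k))
    (i : Fin 3) : c (i + 1) 0 0 + c i 0 1 = 0 := by
  have h := (QuadraticData.mem_dual_rel _ _).1 hφ _ (nap_rel_mem K i)
  simp only [Pi.sub_apply, map_sub, Finset.sum_sub_distrib,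
    QuadraticData.sum_dualPairing_single_right] at h
  rw [hc, hc] at h
  simpa [dualPairing_napDualBasis, coordPair_basis] using h

theorem moor_iso : Nonempty ((Moor K).Iso (napData K).dual.operad) := by
  refine QuadraticData.nonempty_iso_operad (napDualBasis K) (swap_napDualBasis K) ?_ ?_
  · rintro _ (rfl | rfl)
    · refine ⟨_, (napDual_rel_mem K 1).1, ?_⟩
      rw [map_sub, map_sub, (QuadraticData.freeIso_symm_toFree_single (napDualBasis K)
          (swap_napDualBasis K) (1 + 1)).1,
        (QuadraticData.freeIso_symm_toFree_single (napDualBasis K) (swap_napDualBasis K) 1).2.1]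
      rfl
    · exact ⟨_, (napDual_rel_mem K 0).2, (QuadraticData.freeIso_symm_toFree_single
        (napDualBasis K) (swap_napDualBasis K) 0).2.2⟩
  · intro φ hφ
    choose c hc using fun i => QuadraticData.exists_coordinates (napDualBasis K) (φ i)
    rw [QuadraticData.freeIso_symm_toFree (napDualBasis K) (swap_napDualBasis K) φ c hc,
      Finset.sum_add_distrib, map_add,
      sum_leftComb_eq_zero _ (Or.inl rfl) (fun i => c i 0 0) (fun i => c i 0 1)
        (coordinates_of_mem_dual_rel K hφ c hc), zero_add]
    have hright {i j k : Fin 3} (h : [i, j, k].Nodup) :=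
      toQuotient_rightComb (moorRelations K) (Or.inr rfl) h
    simp only [map_sum, map_add, map_smul, hright, smul_zero, add_zero, Finset.sum_const_zero]

theorem isQuadraticDual_nap_moor : Operad.IsQuadraticDual (NAP K) (Moor K) :=
  ⟨napData K, nap_iso K, moor_iso K⟩

end Dual

/-! ### `Moor`-algebras -/

section MoorAlgebra

variable {K : Type u} [Field K] {A : Type v} [AddCommGroup A] [Module K A]

/-- The operation of a `Moor`-algebra as a bilinear map. -/
noncomputable def moorBilin (α : (Moor K).Algebra A) : A →ₗ[K] A →ₗ[K] A :=
  have h0 (a b x : A) : Function.update ![a, b] 0 x = ![x, b] := by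
    ext i; fin_cases i <;> rfl
  have h1 (a b x : A) : Function.update ![a, b] 1 x = ![a, x] := by
    ext i; fin_cases i <;> rfl
  LinearMap.mk₂ K (moorOp α)
    (fun a a' b => by simpa [moorOp, h0] using (α.act (moorGen K)).map_update_add ![a, b] 0 a a')
    (fun c a b => by simpa [moorOp, h0] using (α.act (moorGen K)).map_update_smul ![a, b] 0 c a)
    (fun a b b' => by simpa [moorOp, h1] using (α.act (moorGen K)).map_update_add ![a, b] 1 b b')
    (fun c a b => by simpa [moorOp, h1] using (α.act (moorGen K)).map_update_smul ![a, b] 1 c b)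

theorem moorBilin_apply (α : (Moor K).Algebra A) (a b : A) : moorBilin α a b = moorOp α a b := rfl

/-- The class of a linear tree in `Moor`. -/
noncomputable def LinTree.toMoor (K : Type u) [Field K] {S : Type} [Finite S]
    (t : LinTree PUnit.{u + 1} S) : (Moor K).obj S :=
  (freeOperad K PUnit.{u + 1}).toQuotient 3 (moorRelations K) S (t.toOperad K)

theorem toMoor_map {S T : Type} [Finite S] [Finite T] (σ : S ≃ T) (t : LinTree PUnit.{u + 1} S) :
    (t.map σ).toMoor K = (Moor K).map σ (t.toMoor K) :=
  congrArg ((freeOperad K PUnit.{u + 1}).toQuotient 3 (moorRelations K) T)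
    (freeOperad_map_toOperad σ t).symm

theorem toMoor_comp {S T : Type} [Finite S] [Finite T] (t : LinTree PUnit.{u + 1} (Option S))
    (t' : LinTree PUnit.{u + 1} T) :
    (t.comp t').toMoor K = (Moor K).comp (t.toMoor K) (t'.toMoor K) :=
  congrArg ((freeOperad K PUnit.{u + 1}).toQuotient 3 (moorRelations K) (S ⊕ T))
    (freeOperad_comp_toOperad t t').symm

@[elab_as_elim]
theorem Moor.induction {S : Type} [Finite S] {motive : (Moor K).obj S → Prop} (p : (Moor K).obj S)
    (tree : ∀ t : LinTree PUnit.{u + 1} S, motive (t.toMoor K)) (zero : motive 0)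
    (add : ∀ p q, motive p → motive q → motive (p + q))
    (smul : ∀ (c : K) p, motive p → motive (c • p)) : motive p := by
  obtain ⟨p, rfl⟩ := Operad.toQuotient_surjective _ 3 (moorRelations K) S p
  induction p using freeOperad_induction with
  | tree t => exact tree t
  | zero => rw [LinearMap.map_zero]; exact zero
  | add p q hp hq => rw [map_add]; exact add _ _ hp hq
  | smul c p hp => rw [map_smul]; exact smul c _ hp

/-- The trees act on a `Moor`-algebra by iterating its operation. -/
theorem act_toMoor (α : (Moor K).Algebra A) {S : Type} [Finite S] (t : LinTree PUnit.{u + 1} S)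
    (a : S → A) : α.act (t.toMoor K) a = t.1.eval (fun _ => moorOp α) a := by
  revert a
  refine LinTree.induction (motive := fun S _ t => ∀ a : S → A, α.act (t.toMoor K) a =
    t.1.eval (fun _ => moorOp α) a) ?_ ?_ ?_ ?_ t
  · exact α.act_one
  · intro x a
    refine congrArg (α.act (moorGen K)) (funext fun i => ?_)
    fin_cases i <;> rfl
  · intro S T _ _ σ t ht a
    rw [toMoor_map, α.act_map, ht, LinTree.map_coe, BinTree.eval_bind]
    rfl
  · intro S T _ _ t t' ht ht' a
    rw [toMoor_comp, α.act_comp, ht, ht', LinTree.comp_coe, BinTree.eval_bind]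
    congr 1
    funext o
    cases o with
    | none => exact (BinTree.eval_bind _ t'.1 (fun s => .leaf (Sum.inr s)) a).symm
    | some s => rfl

theorem moorOp_comm (α : (Moor K).Algebra A) (a b c : A) :
    moorOp α (moorOp α a b) c = moorOp α (moorOp α a c) b := by
  have h := toQuotient_leftComb_comm (moorRelations K) (Or.inl rfl) (i := 0) (j := 1) (k := 2)
    (by decide) (by decide)
  have h' := congrArg (fun p => α.act p ![a, b, c]) h
  exact (act_toMoor α _ _).symm.trans (h'.trans (act_toMoor α _ _))

theorem moorOp_moorOp_right (α : (Moor K).Algebra A) (a b c : A) :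
    moorOp α a (moorOp α b c) = 0 := by
  have h := toQuotient_rightComb (moorRelations K) (Or.inr rfl) (i := 0) (j := 1) (k := 2)
    (by decide)
  have h' := congrArg (fun p => α.act p ![a, b, c]) h
  exact (act_toMoor α _ _).symm.trans (h'.trans
    (congrArg (fun m : MultilinearMap K (fun _ : Fin 3 => A) A => m ![a, b, c])
      (LinearMap.map_zero α.act)))

/-- A bilinear operation which satisfies the relations of `Moor` is a structure of
`Moor`-algebra. -/
noncomputable def moorAlgebra (op : A →ₗ[K] A →ₗ[K] A)
    (hcomm : ∀ a b c, op (op a b) c = op (op a c) b) (hzero : ∀ a b c, op a (op b c) = 0) :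
    (Moor K).Algebra A :=
  (treeAlgebra fun _ => op).quotient (R := moorRelations K) (by
    rintro _ (rfl | rfl)
    · ext a
      rw [map_sub, sub_apply, zero_apply, sub_eq_zero]
      have h (i j k : Fin 3) (h : [i, j, k].Nodup) : (treeAlgebra fun _ => op).act
          (leftComb K i j k h) a = op (op (a i) (a j)) (a k) := treeAct_toOperad _ _ _
      rw [h, h, hcomm]
    · ext a
      exact (treeAct_toOperad _ _ _).trans (hzero _ _ _))

theorem moorOp_moorAlgebra (op : A →ₗ[K] A →ₗ[K] A)
    (hcomm : ∀ a b c, op (op a b) c = op (op a c) b) (hzero : ∀ a b c, op a (op b c) = 0)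
    (a b : A) : moorOp (moorAlgebra op hcomm hzero) a b = op a b :=
  treeAct_toOperad _ (LinTree.corolla PUnit.unit) _

variable {B : Type w} [AddCommGroup B] [Module K B]

/-- The morphisms of `Moor`-algebras are the linear maps compatible with the operation. -/
theorem isHom_iff_moorOp (α : (Moor K).Algebra A) (β : (Moor K).Algebra B) (g : A →ₗ[K] B) :
    α.IsHom β g ↔ ∀ a b, g (moorOp α a b) = moorOp β (g a) (g b) := by
  constructor
  · intro h a b
    refine (h (Fin 2) (moorGen K) ![a, b]).trans (congrArg (β.act (moorGen K)) (funext fun i => ?_))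
    fin_cases i <;> rfl
  · intro h S _ p a
    induction p using Moor.induction with
    | tree t =>
      rw [act_toMoor, act_toMoor]
      generalize t.1 = t
      induction t with
      | leaf s => rfl
      | node x l r hl hr => exact (h _ _).trans (congrArg₂ _ hl hr)
    | zero => simp only [map_zero, zero_apply]
    | add p q hp hq => simp only [map_add, add_apply, hp, hq]
    | smul c p hp => simp only [map_smul, smul_apply, hp]

end MoorAlgebra

/-! ### The free `Moor`-algebra -/

section FreeMoor

variable (K : Type u) [Field K] (V : Type v) [AddCommGroup V] [Module K V]

/-- The projection of `V ⊗ S(V)` on `V ⊗ K = V`, followed by the inclusion in `S(V)`. -/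
noncomputable def freeMoorProj : V ⊗[K] SymmetricAlgebra K V →ₗ[K] SymmetricAlgebra K V :=
  SymmetricAlgebra.ι K V ∘ₗ (TensorProduct.rid K V).toLinearMap ∘ₗ
    LinearMap.lTensor V (SymmetricAlgebra.algebraMapInv (R := K) (M := V)).toLinearMap

/-- The operation of the free `Moor`-algebra: the right factor acts on `V ⊗ S(V)` by the
multiplication by its projection on `V`. -/
noncomputable def freeMoorOp : V ⊗[K] SymmetricAlgebra K V →ₗ[K]
    V ⊗[K] SymmetricAlgebra K V →ₗ[K] V ⊗[K] SymmetricAlgebra K V :=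
  (LinearMap.lTensorHom V ∘ₗ LinearMap.mul K (SymmetricAlgebra K V) ∘ₗ freeMoorProj K V).flip

variable {K V}

theorem freeMoorProj_tmul (v : V) (ω : SymmetricAlgebra K V) :
    freeMoorProj K V (v ⊗ₜ ω) =
      SymmetricAlgebra.algebraMapInv ω • SymmetricAlgebra.ι K V v := by
  simp [freeMoorProj]

theorem freeMoorOp_tmul (v : V) (ω : SymmetricAlgebra K V) (y : V ⊗[K] SymmetricAlgebra K V) :
    freeMoorOp K V (v ⊗ₜ ω) y = v ⊗ₜ (freeMoorProj K V y * ω) := rfl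

theorem algebraMapInv_freeMoorProj (x : V ⊗[K] SymmetricAlgebra K V) :
    SymmetricAlgebra.algebraMapInv (freeMoorProj K V x) = 0 :=
  SymmetricAlgebra.algebraMapInv_ι _

theorem freeMoorOp_comm (x y z : V ⊗[K] SymmetricAlgebra K V) :
    freeMoorOp K V (freeMoorOp K V x y) z = freeMoorOp K V (freeMoorOp K V x z) y := by
  induction x using TensorProduct.induction_on with
  | zero => simp
  | add x x' h h' => simp only [map_add, LinearMap.add_apply, h, h']
  | tmul v ω => simp only [freeMoorOp_tmul, mul_left_comm]

theorem freeMoorOp_freeMoorOp_right (x y z : V ⊗[K] SymmetricAlgebra K V) :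
    freeMoorOp K V x (freeMoorOp K V y z) = 0 := by
  have h : freeMoorProj K V (freeMoorOp K V y z) = 0 := by
    induction y using TensorProduct.induction_on with
    | zero => simp
    | add y y' h h' => simp only [map_add, LinearMap.add_apply, h, h', add_zero]
    | tmul v ω =>
      rw [freeMoorOp_tmul, freeMoorProj_tmul, map_mul, algebraMapInv_freeMoorProj, zero_mul,
        zero_smul]
  induction x using TensorProduct.induction_on with
  | zero => simp
  | add x x' h h' => simp only [map_add, LinearMap.add_apply, h, h', add_zero]
  | tmul v ω => rw [freeMoorOp_tmul, h, zero_mul, TensorProduct.tmul_zero]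

variable (K V) in
/-- The structure of `Moor`-algebra of `V ⊗ S(V)`. -/
noncomputable def freeMoorAlgebra : (Moor K).Algebra (V ⊗[K] SymmetricAlgebra K V) :=
  moorAlgebra (freeMoorOp K V) freeMoorOp_comm freeMoorOp_freeMoorOp_right

theorem moorOp_freeMoorAlgebra (x y : V ⊗[K] SymmetricAlgebra K V) :
    moorOp (freeMoorAlgebra K V) x y = freeMoorOp K V x y :=
  moorOp_moorAlgebra _ _ _ x y

variable {A : Type w} [AddCommGroup A] [Module K A] (β : (Moor K).Algebra A) (f : V →ₗ[K] A)

open scoped IsMulCommutative in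
/-- The right multiplications of a `Moor`-algebra commute, so that the symmetric algebra of `V`
acts on every `Moor`-algebra with a linear map from `V`. -/
theorem exists_symmetricAlgebra_action :
    ∃ ρ : SymmetricAlgebra K V →ₐ[K] Module.End K A,
      ∀ v a, ρ (SymmetricAlgebra.ι K V v) a = moorOp β a (f v) := by
  let R : V →ₗ[K] Module.End K A := (moorBilin β).flip ∘ₗ f
  have hR (v : V) (a : A) : R v a = moorOp β a (f v) := rfl
  have hcomm : ∀ x ∈ Set.range R, ∀ y ∈ Set.range R, x * y = y * x := by
    rintro _ ⟨v, rfl⟩ _ ⟨v', rfl⟩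
    ext a
    exact moorOp_comm β a (f v') (f v)
  have := Algebra.isMulCommutative_adjoin K hcomm
  let R' : V →ₗ[K] Algebra.adjoin K (Set.range R) :=
    R.codRestrict (Subalgebra.toSubmodule (Algebra.adjoin K (Set.range R)))
      fun v => Algebra.subset_adjoin ⟨v, rfl⟩
  let L : SymmetricAlgebra K V →ₐ[K] Algebra.adjoin K (Set.range R) := SymmetricAlgebra.lift R'
  refine ⟨(Algebra.adjoin K (Set.range R)).val.comp L, fun v a => ?_⟩
  have h := congrArg Subtype.val (SymmetricAlgebra.lift_ι_apply R' v)
  exact (congrArg (fun e : Module.End K A => e a) h).trans (hR v a)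

/-- A right multiplication by a product vanishes. -/
theorem moorOp_action {ρ : SymmetricAlgebra K V →ₐ[K] Module.End K A}
    (hρ : ∀ v a, ρ (SymmetricAlgebra.ι K V v) a = moorOp β a (f v))
    (ω : SymmetricAlgebra K V) (x a : A) :
    moorOp β x (ρ ω a) = SymmetricAlgebra.algebraMapInv ω • moorOp β x a := by
  induction ω using SymmetricAlgebra.induction generalizing a with
  | algebraMap c =>
    rw [AlgHom.commutes, Module.algebraMap_end_apply, ← moorBilin_apply, map_smul,
      SymmetricAlgebra.algebraMap_leftInverse, moorBilin_apply]
  | ι v =>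
    rw [hρ, moorOp_moorOp_right, SymmetricAlgebra.algebraMapInv_ι, zero_smul]
  | mul ω ω' h h' => rw [map_mul, Module.End.mul_apply, h, h', map_mul, mul_smul]
  | add ω ω' h h' =>
    rw [map_add, LinearMap.add_apply, ← moorBilin_apply, map_add, moorBilin_apply,
      moorBilin_apply, h, h', map_add, add_smul]

theorem exists_hom_freeMoorAlgebra :
    ∃ g : V ⊗[K] SymmetricAlgebra K V →ₗ[K] A,
      (freeMoorAlgebra K V).IsHom β g ∧ ∀ v : V, g (v ⊗ₜ 1) = f v := by
  obtain ⟨ρ, hρ⟩ := exists_symmetricAlgebra_action β f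
  let g : V ⊗[K] SymmetricAlgebra K V →ₗ[K] A := TensorProduct.lift (ρ.toLinearMap.flip ∘ₗ f)
  have hg (v : V) (ω : SymmetricAlgebra K V) : g (v ⊗ₜ ω) = ρ ω (f v) := rfl
  have hproj (x : A) (y : V ⊗[K] SymmetricAlgebra K V) :
      ρ (freeMoorProj K V y) x = moorOp β x (g y) := by
    rw [← moorBilin_apply]
    induction y using TensorProduct.induction_on with
    | zero => simp
    | add y y' h h' => simp only [map_add, LinearMap.add_apply, h, h']
    | tmul v ω =>
      rw [freeMoorProj_tmul, map_smul, LinearMap.smul_apply, hρ, hg, moorBilin_apply,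
        moorOp_action β f hρ]
  refine ⟨g, (isHom_iff_moorOp _ _ _).2 fun x y => ?_, fun v => ?_⟩
  · rw [moorOp_freeMoorAlgebra, ← moorBilin_apply]
    induction x using TensorProduct.induction_on with
    | zero => simp
    | add x x' h h' => simp only [map_add, LinearMap.add_apply, h, h']
    | tmul v ω =>
      rw [freeMoorOp_tmul, hg, hg, map_mul, Module.End.mul_apply, hproj, moorBilin_apply]
  · rw [hg, map_one, Module.End.one_apply]

theorem hom_freeMoorAlgebra_unique {g g' : V ⊗[K] SymmetricAlgebra K V →ₗ[K] A}
    (hg : (freeMoorAlgebra K V).IsHom β g) (hg' : (freeMoorAlgebra K V).IsHom β g')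
    (h : ∀ v : V, g (v ⊗ₜ 1) = g' (v ⊗ₜ 1)) : g = g' := by
  have hmul (ω : SymmetricAlgebra K V) : ∀ (v : V) (ω' : SymmetricAlgebra K V),
      g (v ⊗ₜ ω') = g' (v ⊗ₜ ω') → g (v ⊗ₜ (ω * ω')) = g' (v ⊗ₜ (ω * ω')) := by
    induction ω using SymmetricAlgebra.induction with
    | algebraMap c =>
      intro v ω' h'
      rw [← Algebra.smul_def, TensorProduct.tmul_smul, map_smul, map_smul, h']
    | ι v' =>
      intro v ω' h'
      have hop : v ⊗ₜ (SymmetricAlgebra.ι K V v' * ω') =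
          moorOp (freeMoorAlgebra K V) (v ⊗ₜ ω') (v' ⊗ₜ 1) := by
        rw [moorOp_freeMoorAlgebra, freeMoorOp_tmul, freeMoorProj_tmul, map_one, one_smul]
      rw [hop, (isHom_iff_moorOp _ _ _).1 hg, (isHom_iff_moorOp _ _ _).1 hg', h', h]
    | mul ω₁ ω₂ h₁ h₂ =>
      intro v ω' h'
      rw [mul_assoc]
      exact h₁ v _ (h₂ v _ h')
    | add ω₁ ω₂ h₁ h₂ =>
      intro v ω' h'
      rw [add_mul, TensorProduct.tmul_add, map_add, map_add, h₁ v _ h', h₂ v _ h']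
  refine TensorProduct.ext' fun v ω => ?_
  simpa using hmul ω v 1 (h v)

theorem moorOp_free_algebraMap (v v' : V) (ω : SymmetricAlgebra K V) (c : K) :
    moorOp (freeMoorAlgebra K V) (v ⊗ₜ ω) (v' ⊗ₜ algebraMap K (SymmetricAlgebra K V) c) =
      c • (v ⊗ₜ[K] (ω * SymmetricAlgebra.ι K V v')) := by
  rw [moorOp_freeMoorAlgebra, freeMoorOp_tmul, freeMoorProj_tmul,
    SymmetricAlgebra.algebraMap_leftInverse, smul_mul_assoc, TensorProduct.tmul_smul, mul_comm]

theorem moorOp_free_prod (v v' : V) (ω : SymmetricAlgebra K V) (l : List V) (hl : l ≠ []) :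
    moorOp (freeMoorAlgebra K V) (v ⊗ₜ ω)
      (v' ⊗ₜ (l.map (SymmetricAlgebra.ι K V)).prod) = 0 := by
  cases l with
  | nil => exact absurd rfl hl
  | cons x l =>
    rw [moorOp_freeMoorAlgebra, freeMoorOp_tmul, freeMoorProj_tmul, List.map_cons, List.prod_cons,
      map_mul, SymmetricAlgebra.algebraMapInv_ι, zero_mul, zero_smul, zero_mul,
      TensorProduct.tmul_zero]

end FreeMoor

/-! ### The dimensions of `Moor` -/

namespace BinTree

variable {S T : Type}

/-- The left comb `(…((t ≺ s₁) ≺ s₂)…) ≺ sₙ` on a tree `t` and a list `[s₁, …, sₙ]` of labels. -/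
def comb : BinTree PUnit.{u + 1} S → List S → BinTree PUnit.{u + 1} S
  | t, [] => t
  | t, s :: l => comb (node .unit t (leaf s)) l

theorem leaves_comb (t : BinTree PUnit.{u + 1} S) (l : List S) :
    (t.comb l).leaves = t.leaves ++ l := by
  induction l generalizing t with
  | nil => simp [comb]
  | cons s l ih => simp [comb, ih, leaves]

theorem comb_append (t : BinTree PUnit.{u + 1} S) (l l' : List S) :
    t.comb (l ++ l') = (t.comb l).comb l' := by
  induction l generalizing t with
  | nil => rfl
  | cons s l ih => exact ih _

theorem comb_bind {ι : Type} (t : BinTree PUnit.{u + 1} S) (l : List ι) (i : ι → S) (j : ι → T)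
    (f : S → BinTree PUnit.{u + 1} T) (h : ∀ x, f (i x) = leaf (j x)) :
    (t.comb (l.map i)).bind f = (t.bind f).comb (l.map j) := by
  induction l generalizing t with
  | nil => rfl
  | cons x l ih =>
    simp only [List.map_cons, comb, ih, bind, h]

theorem isLinear_comb (t : BinTree PUnit.{u + 1} S) (l : List S) :
    (t.comb l).IsLinear ↔ (t.leaves ++ l).Nodup ∧ ∀ s, s ∈ t.leaves ++ l := by
  rw [IsLinear, leaves_comb]

end BinTree

/-- A linear tree from a tree and the proof of its linearity. -/
def LinTree.mk {X : Type u} {S : Type} (t : BinTree X S) (h : t.IsLinear) : LinTree X S := ⟨t, h⟩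

theorem LinTree.mk_coe {X : Type u} {S : Type} (t : BinTree X S) (h : t.IsLinear) :
    (LinTree.mk t h).1 = t := rfl

section Dimension

open BinTree

variable {K : Type u} [Field K] {S : Type} [Finite S]

/-- Substitution in an operation `A` of arity three of a tree `t` and of two labels `x, y`, followed
by the formation of a left comb, as a linear map on `Moor`. -/
theorem exists_substitution (t : BinTree PUnit.{u + 1} S) (x y : S) (l : List S)
    (hnd : (t.leaves ++ x :: y :: l).Nodup) (hmem : ∀ s, s ∈ t.leaves ++ x :: y :: l) :
    ∃ F : (Moor K).obj (Option (Fin 2)) →ₗ[K] (Moor K).obj S,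
      ∀ A : LinTree PUnit.{u + 1} (Option (Fin 2)),
        ∃ h : ((A.1.bind fun o => o.elim t ![leaf x, leaf y]).comb l).IsLinear,
          F (A.toMoor K) = (LinTree.mk _ h).toMoor K := by
  have htl : t.leaves.Nodup := (List.nodup_append.1 hnd).1
  have hxyl : (x :: y :: l).Nodup := (List.nodup_append.1 hnd).2.1
  have hdisj := (List.nodup_append.1 hnd).2.2
  obtain ⟨t', ht'⟩ := t.exists_linear_bind_val htl
  have hl : l.Nodup := hxyl.of_cons.of_cons
  have hx : x ∉ y :: l := (List.nodup_cons.1 hxyl).1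
  have hy : y ∉ l := (List.nodup_cons.1 hxyl.of_cons).1
  let C : LinTree PUnit.{u + 1} (Option {s // s ∈ l}) :=
    ⟨(leaf none).comb (l.attach.map some), by
      rw [isLinear_comb]
      constructor
      · simp [leaves, List.nodup_cons, List.nodup_map_iff (Option.some_injective _), hl]
      · rintro (_ | s) <;> simp [leaves]⟩
  let σ : {s // s ∈ l} ⊕ (Fin 2 ⊕ {s // s ∈ t.leaves}) ≃ S :=
    Equiv.ofBijective (Sum.elim Subtype.val (Sum.elim ![x, y] Subtype.val)) ⟨by
      have hinj : Function.Injective ![x, y] := by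
        intro i j hij
        fin_cases i <;> fin_cases j <;> simp_all
      have h2 : Function.Injective (Sum.elim ![x, y] (Subtype.val : {s // s ∈ t.leaves} → S)) := by
        refine hinj.sumElim Subtype.val_injective fun i s => ?_
        have := hdisj s.1 s.2 (![x, y] i) (by fin_cases i <;> simp)
        exact fun h => this h.symm
      refine Subtype.val_injective.sumElim h2 ?_
      rintro ⟨s, hs⟩ (i | ⟨s', hs'⟩)
      · fin_cases i
        · rintro rfl
          exact hx (by simp [hs])
        · rintro rfl
          exact hy hs
      · rintro rfl
        exact hdisj _ hs' _ (by simp [hs]) rfl, fun s => by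
      have hs := hmem s
      simp only [List.mem_append, List.mem_cons] at hs
      rcases hs with hs | rfl | rfl | hs
      exacts [⟨Sum.inr (Sum.inr ⟨s, hs⟩), rfl⟩, ⟨Sum.inr (Sum.inl 0), rfl⟩,
        ⟨Sum.inr (Sum.inl 1), rfl⟩, ⟨Sum.inl ⟨s, hs⟩, rfl⟩]⟩
  refine ⟨(Moor K).map σ ∘ₗ (Moor K).comp (C.toMoor K) ∘ₗ
    (Moor K).comp.flip (t'.toMoor K), fun A => ?_⟩
  have hA : ((C.comp (A.comp t')).map σ).1 =
      (A.1.bind fun o => o.elim t ![leaf x, leaf y]).comb l := by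
    rw [LinTree.map_coe, LinTree.comp_coe, bind_bind]
    refine (comb_bind (leaf none) l.attach some Subtype.val _ fun _ => rfl).trans ?_
    rw [List.attach_map_subtype_val]
    refine congrArg (fun u => comb u l) ?_
    simp only [BinTree.bind, graftFun, LinTree.comp_coe, bind_bind]
    refine congrArg A.1.bind (funext fun o => ?_)
    rcases o with _ | i
    · exact (bind_bind _ _ _).trans ht'
    · fin_cases i <;> rfl
  refine ⟨hA ▸ ((C.comp (A.comp t')).map σ).2, ?_⟩
  simp only [LinearMap.comp_apply, LinearMap.flip_apply, ← toMoor_comp, ← toMoor_map]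
  exact congrArg (LinTree.toMoor K) (Subtype.ext hA)

theorem exists_comb_swap (t : BinTree PUnit.{u + 1} S) (x y : S) (l : List S)
    (h : (t.comb (x :: y :: l)).IsLinear) :
    ∃ h' : (t.comb (y :: x :: l)).IsLinear,
      (LinTree.mk _ h').toMoor K = (LinTree.mk _ h).toMoor K := by
  rw [isLinear_comb] at h
  obtain ⟨F, hF⟩ := exists_substitution (K := K) t x y l h.1 h.2
  have hrel := toQuotient_leftComb_comm (moorRelations K) (Or.inl rfl) (i := 0) (j := 1) (k := 2)
    (by decide) (by decide)
  have hrel' := congrArg (fun p => F ((Moor K).map (finSuccEquiv 2) p)) hrel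
  let A (i j k : Fin 3) (h : [i, j, k].Nodup) : LinTree PUnit.{u + 1} (Fin 3) :=
    ⟨.node .unit (.node .unit (.leaf i) (.leaf j)) (.leaf k), h, by
      change ∀ s, s ∈ [i, j, k]; revert i j k; decide⟩
  obtain ⟨h₁, e₁⟩ := hF ((A 0 1 2 (by decide)).map (finSuccEquiv 2))
  obtain ⟨h₂, e₂⟩ := hF ((A 0 2 1 (by decide)).map (finSuccEquiv 2))
  rw [toMoor_map] at e₁ e₂
  exact ⟨h₂, (e₁.symm.trans (hrel'.trans e₂)).symm⟩

/-- A product on the right of the first step of a comb makes the comb vanish in `Moor`. -/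
theorem toMoor_comb_eq_zero (t : BinTree PUnit.{u + 1} S) (x y : S) (l : List S)
    (h : ((node .unit (leaf x) (node .unit t (leaf y))).comb l).IsLinear) :
    (LinTree.mk _ h).toMoor K = 0 := by
  have hl := (isLinear_comb _ _).1 h
  simp only [leaves] at hl
  have hp : ([x] ++ (t.leaves ++ [y]) ++ l).Perm (t.leaves ++ x :: y :: l) := by
    simpa using (List.perm_middle (a := x) (l₁ := t.leaves) (l₂ := y :: l)).symm
  obtain ⟨F, hF⟩ := exists_substitution (K := K) t x y l (hp.nodup_iff.1 hl.1)
    fun s => hp.mem_iff.1 (hl.2 s)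
  have hrel := toQuotient_rightComb (moorRelations K) (Or.inr rfl) (i := 1) (j := 0) (k := 2)
    (by decide)
  have hrel' := congrArg (fun p => F ((Moor K).map (finSuccEquiv 2) p)) hrel
  let A : LinTree PUnit.{u + 1} (Fin 3) :=
    ⟨.node .unit (.leaf 1) (.node .unit (.leaf 0) (.leaf 2)), by simp [leaves], by
      simp only [leaves]; decide⟩
  obtain ⟨h₁, e₁⟩ := hF (A.map (finSuccEquiv 2))
  rw [toMoor_map] at e₁
  refine e₁.symm.trans (hrel'.trans ?_)
  exact (congrArg F (LinearMap.map_zero _)).trans (LinearMap.map_zero F)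

omit [Finite S] in
theorem isLinear_comb_perm {t : BinTree PUnit.{u + 1} S} {l l' : List S} (hl : l.Perm l')
    (h : (t.comb l).IsLinear) : (t.comb l').IsLinear := by
  rw [isLinear_comb] at h ⊢
  have hp := hl.append_left t.leaves
  exact ⟨hp.nodup_iff.1 h.1, fun s => hp.mem_iff.1 (h.2 s)⟩

theorem toMoor_comb_perm {t : BinTree PUnit.{u + 1} S} {l l' : List S} (hl : l.Perm l')
    (h : (t.comb l).IsLinear) :
    (LinTree.mk _ h).toMoor K = (LinTree.mk _ (isLinear_comb_perm hl h)).toMoor K := by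
  induction hl generalizing t with
  | nil => rfl
  | cons s _ ih => exact ih h
  | swap x y l =>
    obtain ⟨_, e⟩ := exists_comb_swap (K := K) t y x l h
    exact e.symm
  | trans h₁ _ ih₁ ih₂ => exact (ih₁ h).trans (ih₂ _)

variable (K S) in
/-- The subspace of `Moor` spanned by the left combs. -/
noncomputable def combSpan : Submodule K ((Moor K).obj S) :=
  Submodule.span K {p | ∃ (s : S) (l : List S) (h : ((leaf s).comb l).IsLinear),
    p = (LinTree.mk _ h).toMoor K}

theorem toMoor_mem_combSpan (t : LinTree PUnit.{u + 1} S) {s : S} {l : List S}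
    (h : t.1 = (leaf s).comb l) : t.toMoor K ∈ combSpan K S := by
  have ht := t.2
  rw [h] at ht
  exact Submodule.subset_span ⟨s, l, ht, congrArg (LinTree.toMoor K) (Subtype.ext h)⟩

omit [Finite S] in
theorem exists_map_some {l : List (Option S)} (h : none ∉ l) : ∃ l' : List S, l = l'.map some := by
  induction l with
  | nil => exact ⟨[], rfl⟩
  | cons o l ih =>
    simp only [List.mem_cons, not_or] at h
    obtain ⟨l', rfl⟩ := ih h.2
    obtain ⟨s, rfl⟩ := Option.ne_none_iff_exists'.1 (Ne.symm h.1)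
    exact ⟨s :: l', rfl⟩

/-- The span of the left combs is closed under composition: at the root a comb can be grafted, at
another leaf, moved to the first step, only a single leaf gives a nonzero result. -/
theorem comp_comb_mem_combSpan {T : Type} [Finite T] {o : Option S} {l : List (Option S)}
    (h : ((leaf o).comb l).IsLinear) {s : T} {l' : List T} (h' : ((leaf s).comb l').IsLinear) :
    (Moor K).comp ((LinTree.mk _ h).toMoor K) ((LinTree.mk _ h').toMoor K) ∈ combSpan K (S ⊕ T) := by
  have hl := (isLinear_comb _ _).1 h
  simp only [leaves, List.singleton_append, List.nodup_cons, List.mem_cons] at hl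
  cases o with
  | none =>
    obtain ⟨m, rfl⟩ := exists_map_some hl.1.1
    rw [← toMoor_comp]
    refine toMoor_mem_combSpan (s := Sum.inr s) (l := l'.map Sum.inr ++ m.map Sum.inl) _ ?_
    rw [LinTree.comp_coe, comb_append]
    refine (comb_bind _ m some Sum.inl _ fun _ => rfl).trans
      (congrArg (fun u => comb u (m.map Sum.inl)) ?_)
    simpa [BinTree.bind, graftFun, LinTree.mk_coe] using comb_bind (leaf s) l' id Sum.inr (fun t => leaf (Sum.inr t))
      fun _ => rfl
  | some a =>
    classical
    have hmem : none ∈ l := by simpa using hl.2 none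
    have hp := List.perm_cons_erase hmem
    obtain ⟨m, hm⟩ := exists_map_some (hl.1.2.not_mem_erase (a := none))
    rw [hm] at hp
    rw [toMoor_comb_perm hp, ← toMoor_comp]
    have hb : ((LinTree.mk _ (isLinear_comb_perm hp h)).comp (LinTree.mk _ h')).1 = (node .unit (leaf (Sum.inl a)) ((leaf (Sum.inr s)).comb
          (l'.map Sum.inr))).comb (m.map Sum.inl) := by
      rw [LinTree.comp_coe]
      refine (comb_bind _ m some Sum.inl _ fun _ => rfl).trans
        (congrArg (fun u => comb u (m.map Sum.inl)) ?_)
      simpa [BinTree.bind, graftFun, LinTree.mk_coe] using comb_bind (leaf s) l' id Sum.inr (fun t => leaf (Sum.inr t))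
        fun _ => rfl
    rcases List.eq_nil_or_concat' l' with rfl | ⟨l', y, rfl⟩
    · exact toMoor_mem_combSpan (s := Sum.inl a) (l := Sum.inr s :: m.map Sum.inl) _ hb
    · have hb' : ((LinTree.mk _ (isLinear_comb_perm hp h)).comp (LinTree.mk _ h')).1 =
          (node .unit (leaf (Sum.inl a)) (node .unit ((leaf (Sum.inr s)).comb (l'.map Sum.inr))
            (leaf (Sum.inr y)))).comb (m.map Sum.inl) := by
        rw [hb, List.map_append, comb_append]
        rfl
      have hlin := ((LinTree.mk _ (isLinear_comb_perm hp h)).comp (LinTree.mk _ h')).2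
      rw [hb'] at hlin
      have hz : LinTree.toMoor K ((LinTree.mk _ (isLinear_comb_perm hp h)).comp
          (LinTree.mk _ h')) = 0 :=
        (congrArg (LinTree.toMoor K) (Subtype.ext hb')).trans
          (toMoor_comb_eq_zero _ _ _ _ hlin)
      rw [hz]
      exact zero_mem _

theorem comp_mem_combSpan {T : Type} [Finite T] {p : (Moor K).obj (Option S)} {q : (Moor K).obj T}
    (hp : p ∈ combSpan K (Option S)) (hq : q ∈ combSpan K T) :
    (Moor K).comp p q ∈ combSpan K (S ⊕ T) := by
  have h : Submodule.map₂ (Moor K).comp (combSpan K (Option S)) (combSpan K T) ≤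
      combSpan K (S ⊕ T) := by
    rw [combSpan, combSpan, Submodule.map₂_span_span, Submodule.span_le]
    rintro _ ⟨_, ⟨s, l, h, rfl⟩, _, ⟨s', l', h', rfl⟩, rfl⟩
    exact comp_comb_mem_combSpan h h'
  exact h (Submodule.apply_mem_map₂ _ hp hq)

theorem combSpan_eq_top : combSpan K S = ⊤ := by
  have htree (t : LinTree PUnit.{u + 1} S) : t.toMoor K ∈ combSpan K S := by
    refine LinTree.induction (motive := fun S _ t => t.toMoor K ∈ combSpan K S) ?_ ?_ ?_ ?_ t
    · exact toMoor_mem_combSpan (s := ()) (l := []) _ rfl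
    · intro x
      exact toMoor_mem_combSpan (s := 0) (l := [1]) _ rfl
    · intro S T _ _ σ t ht
      rw [toMoor_map]
      have h : combSpan K S ≤ (combSpan K T).comap ((Moor K).map σ) := by
        rw [combSpan, Submodule.span_le]
        rintro _ ⟨s, l, h, rfl⟩
        change (Moor K).map σ _ ∈ combSpan K T
        rw [← toMoor_map]
        refine toMoor_mem_combSpan (s := σ s) (l := l.map σ) _ ?_
        simpa [BinTree.bind, LinTree.map_coe, LinTree.mk_coe] using comb_bind (leaf s) l id σ (fun t => leaf (σ t)) fun _ => rfl
      exact h ht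
    · intro S T _ _ t u ht hu
      rw [toMoor_comp]
      exact comp_mem_combSpan ht hu
  refine eq_top_iff.2 fun p _ => ?_
  induction p using Moor.induction with
  | tree t => exact htree t
  | zero => exact zero_mem _
  | add p q hp hq => exact add_mem (hp trivial) (hq trivial)
  | smul c p hp => exact Submodule.smul_mem (combSpan K S) c (hp trivial)

end Dimension

/-! ### The basis of `Moor` and its generating series -/

section Basis

open BinTree

variable (K : Type u) [Field K] {S : Type} [Fintype S] [DecidableEq S]

theorem isLinear_comb_erase (s : S) :
    ((leaf s : BinTree PUnit.{u + 1} S).comb (Finset.univ.erase s).toList).IsLinear := by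
  rw [isLinear_comb]
  constructor
  · simp [leaves, Finset.nodup_toList]
  · intro s'
    by_cases h : s' = s <;> simp [leaves, h]

/-- The left comb with the label `s` at the root and the other labels in any order. -/
noncomputable def moorComb (s : S) : (Moor K).obj S :=
  (LinTree.mk _ (isLinear_comb_erase s)).toMoor K

theorem span_range_moorComb : Submodule.span K (Set.range (moorComb K : S → _)) = ⊤ := by
  rw [eq_top_iff, ← combSpan_eq_top, combSpan, Submodule.span_le]
  rintro _ ⟨s, l, h, rfl⟩
  have hl := (isLinear_comb _ _).1 h
  simp only [leaves, List.singleton_append, List.nodup_cons, List.mem_cons] at hl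
  have hp : l.Perm (Finset.univ.erase s).toList := by
    rw [List.perm_ext_iff_of_nodup hl.1.2 (Finset.nodup_toList _)]
    intro s'
    have h' := hl.2 s'
    have hs := hl.1.1
    by_cases h'' : s' = s <;> simp_all
  rw [toMoor_comb_perm hp]
  exact Submodule.subset_span ⟨s, rfl⟩

omit [Fintype S] in
/-- The value of a left comb in the free `Moor`-algebra on `K^S`, at the basis vectors: `v ⊗ ω`,
where `v` is the value at the root and `ω` is a product of basis vectors. -/
theorem exists_eval_comb (t : BinTree PUnit.{u + 1} S) (l : List S) {v : S → K}
    (χ : SymmetricAlgebra K (S → K) →ₐ[K] K)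
    (hχ : ∀ s, χ (SymmetricAlgebra.ι K (S → K) (Pi.single s 1)) = 1)
    (ht : ∃ ω, χ ω = 1 ∧ t.eval (fun _ => moorOp (freeMoorAlgebra K (S → K)))
      (fun s => Pi.single s (1 : K) ⊗ₜ[K] 1) = v ⊗ₜ ω) :
    ∃ ω, χ ω = 1 ∧ (t.comb l).eval (fun _ => moorOp (freeMoorAlgebra K (S → K)))
      (fun s => Pi.single s (1 : K) ⊗ₜ[K] 1) = v ⊗ₜ ω := by
  induction l generalizing t with
  | nil => exact ht
  | cons s l ih =>
    obtain ⟨ω, hω, he⟩ := ht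
    refine ih _ ⟨SymmetricAlgebra.ι K (S → K) (Pi.single s 1) * ω, by rw [map_mul, hω, hχ, mul_one],
      ?_⟩
    rw [eval, he, eval, moorOp_freeMoorAlgebra, freeMoorOp_tmul, freeMoorProj_tmul, map_one,
      one_smul]

theorem linearIndependent_moorComb : LinearIndependent K (moorComb K : S → (Moor K).obj S) := by
  let χ : SymmetricAlgebra K (S → K) →ₐ[K] K :=
    SymmetricAlgebra.lift (∑ s, LinearMap.proj s : (S → K) →ₗ[K] K)
  have hχ (s : S) : χ (SymmetricAlgebra.ι K (S → K) (Pi.single s 1)) = 1 := by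
    rw [SymmetricAlgebra.lift_ι_apply]
    simp
  -- the first factor of the value of an operation at the basis vectors
  let Λ : (S → K) ⊗[K] SymmetricAlgebra K (S → K) →ₗ[K] (S → K) :=
    (TensorProduct.rid K (S → K)).toLinearMap ∘ₗ LinearMap.lTensor _ χ.toLinearMap
  let F : (Moor K).obj S →ₗ[K] (S → K) :=
    { toFun := fun p => Λ ((freeMoorAlgebra K (S → K)).act p fun s => Pi.single s (1 : K) ⊗ₜ[K] 1)
      map_add' := fun p q => by rw [map_add, add_apply, map_add]
      map_smul' := fun c p => by rw [map_smul, smul_apply, map_smul]; rfl }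
  have hF (s : S) : F (moorComb K s) = Pi.single s 1 := by
    obtain ⟨ω, hω, he⟩ := exists_eval_comb K (leaf s) (Finset.univ.erase s).toList χ hχ
      ⟨1, map_one χ, rfl⟩
    change Λ ((freeMoorAlgebra K (S → K)).act _ _) = _
    rw [moorComb, act_toMoor, LinTree.mk_coe, he]
    simp [Λ, hω]
  refine LinearIndependent.of_comp F ?_
  have hcomp : F ∘ moorComb K = Pi.basisFun K S := by
    funext s
    rw [Function.comp_apply, hF, Pi.basisFun_apply]
  rw [hcomp]
  exact (Pi.basisFun K S).linearIndependent

/-- The basis of `Moor` given by the choice of a root. -/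
noncomputable def moorBasis : Module.Basis S K ((Moor K).obj S) :=
  Module.Basis.mk (linearIndependent_moorComb K) (span_range_moorComb K).ge

theorem finrank_moor (n : ℕ) : Module.finrank K ((Moor K).obj (Fin n)) = n := by
  rw [Module.finrank_eq_card_basis (moorBasis K), Fintype.card_fin]

theorem genSeries_moor : (Moor K).genSeries = PowerSeries.X * PowerSeries.exp ℚ := by
  ext n
  rw [Operad.genSeries, PowerSeries.coeff_mk, finrank_moor]
  cases n with
  | zero => simp
  | succ n =>
    rw [PowerSeries.coeff_succ_X_mul, PowerSeries.coeff_exp, if_neg n.succ_ne_zero,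
      Nat.factorial_succ]
    push_cast
    have h : (n.factorial : ℚ) ≠ 0 := by exact_mod_cast n.factorial_ne_zero
    have h' : (n : ℚ) + 1 ≠ 0 := by positivity
    field_simp

end Basis



theorem theorem2p1 (K : Type u) [Field K] [CharZero K] :
    -- `Moor` is the dual of `NAP`
    Operad.IsQuadraticDual (NAP K) (Moor K) ∧
    -- the free `Moor`-algebra over `V` is `V ⊗ S(V)`
    (∀ (V : Type v) [AddCommGroup V] [Module K V],
      ∃ α : (Moor K).Algebra (V ⊗[K] SymmetricAlgebra K V),
        (∀ (v v' : V) (ω : SymmetricAlgebra K V) (c : K),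
          moorOp α (v ⊗ₜ ω) (v' ⊗ₜ algebraMap K (SymmetricAlgebra K V) c) =
            c • (v ⊗ₜ[K] (ω * SymmetricAlgebra.ι K V v'))) ∧
        (∀ (v v' : V) (ω : SymmetricAlgebra K V) (l : List V), l ≠ [] →
          moorOp α (v ⊗ₜ ω) (v' ⊗ₜ (l.map (SymmetricAlgebra.ι K V)).prod) = 0) ∧
        ∀ (A : Type w) [AddCommGroup A] [Module K A] (β : (Moor K).Algebra A) (f : V →ₗ[K] A),
          ∃! g : V ⊗[K] SymmetricAlgebra K V →ₗ[K] A,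
            α.IsHom β g ∧ ∀ v : V, g (v ⊗ₜ 1) = f v) ∧
    -- the dimensions and the generating series of `Moor`
    (∀ n : ℕ, Module.Finite K ((Moor K).obj (Fin n)) ∧
      Module.finrank K ((Moor K).obj (Fin n)) = n) ∧
    (Moor K).genSeries = PowerSeries.X * PowerSeries.exp ℚ := by
  exact ⟨isQuadraticDual_nap_moor K,
    fun V _ _ => ⟨freeMoorAlgebra K V, moorOp_free_algebraMap, moorOp_free_prod,
      fun A _ _ β f => by
        obtain ⟨g, hg, hgf⟩ := exists_hom_freeMoorAlgebra β f
        exact ⟨g, ⟨hg, hgf⟩, fun g' hg' => hom_freeMoorAlgebra_unique β hg'.1 hg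
          fun v => (hg'.2 v).trans (hgf v).symm⟩⟩,
    fun n => ⟨.of_basis (moorBasis K), finrank_moor K n⟩, genSeries_moor K⟩
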